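/- All graphs are finite, simple and undirected. An $s$-clique of a graph $G$ is a set of $s$ pairwise adjacent vertices, and $C_s(G)$ is the set of all $s$-cliques of $G$. For $s\ge 2$, the $s$-clique tensor of a graph $G$ with vertices $1,\dots,n$ is the tensor $\mathcal A_s(G)=(a_{i_1\cdots i_s})$ of order $s$ and dimension $n$ with $a_{i_1\cdots i_s}=\frac1{(s-1)!}$ if $\{i_1,\dots,i_s\}\in C_s(G)$ and $a_{i_1\cdots i_s}=0$ otherwise. A number $\lambda\in\mathbb C$ is an eigenvalue of $\mathcal A_s(G)$ if there is a nonzero $x\in\mathbb C^n$ with $\sum_{i_2,\dots,i_s=1}^n a_{i i_2\cdots i_s}x_{i_2}\cdots x_{i_s}=\lambda x_i^{s-1}$ for all $i$. The $s$-clique spectral radius $\mu_s(G)$ is the largest modulus of an eigenvalue of $\mathcal A_s(G)$. Let $2K_r$ be the disjoint union of two copies of the complete graph $K_r$; $G$ is $2K_r$-free if it does not contain $2K_r$ as a (not necessarily induced) subgraph. Let $G\vee H$ be the join of $G$ and $H$, that is, their disjoint union together with all edges between $G$ and $H$. For $p\ge1$ let $T_p(m)$ be the complete $p$-partite graph on $m$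 vertices whose class sizes differ by at most one, and let $T_0(m)$ be the graph without vertices. **Theorem.** Let $r\ge 3$ and $r\le k\le 2r-1$ be integers, let $$n\ \ge\ (2r-k-1)\left(\mathrm e\,r^4k^{k/2}\right)^{\frac{k}{2k-2r+1}}+k,$$ and let $G$ be a $2K_r$-free graph on $n$ vertices. Then $$\mu_k(G)+\mu_{k+1}(G)+\cdots+\mu_{2r-1}(G)\ \le\ \mu_k\bigl(K_{2k-2r+1}\vee T_{2r-k-1}(n-2k+2r-1)\bigr).$$ (i) For $k=2r-1$ (where the graph on the right-hand side is $K_{2r-1}$), equality holds if and only if $|C_k(G)|=1$. (ii) For $r\le k\le 2r-2$, equality holds if and only if $G\cong K_{2k-2r+1}\vee T_{2r-k-1}(n-2k+2r-1)$. -/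

import Mathlib

/-- The vector `A x^{m}` for a complex tensor `A` of order `m + 1` whose indices run over `V`:
its `i`-th entry is `∑ a_{i i₂ … i_{m+1}} x_{i₂} ⋯ x_{i_{m+1}}`. -/
noncomputable def tensorApply {V : Type*} [Fintype V] {m : ℕ} (A : (Fin (m + 1) → V) → ℂ)
    (x : V → ℂ) (i : V) : ℂ :=
  ∑ f : Fin m → V, A (Fin.cons i f) * ∏ j, x (f j)

/-- `l` is an eigenvalue of the tensor `A` of order `m + 1`: `A x^{m} = l x^{[m]}` for some nonzero
complex vector `x`, where `x^{[m]}` is the entrywise power. -/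
def IsTensorEigenvalue {V : Type*} [Fintype V] {m : ℕ} (A : (Fin (m + 1) → V) → ℂ)
    (l : ℂ) : Prop :=
  ∃ x : V → ℂ, x ≠ 0 ∧ ∀ i, tensorApply A x i = l * x i ^ m

/-- The spectral radius of a tensor: the largest modulus of an eigenvalue. -/
noncomputable def tensorSpectralRadius {V : Type*} [Fintype V] {m : ℕ}
    (A : (Fin (m + 1) → V) → ℂ) : ℝ :=
  sSup {t : ℝ | ∃ l : ℂ, IsTensorEigenvalue A l ∧ t = ‖l‖}

open Classical in
/-- The `s`-clique tensor of `G`: the entry at `(i₁, …, i_s)` is `1 / (s - 1)!` if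
`{i₁, …, i_s}` is an `s`-clique of `G`, and `0` otherwise. -/
noncomputable def cliqueTensor {V : Type*} (G : SimpleGraph V) (s : ℕ) (i : Fin s → V) : ℂ :=
  if G.IsNClique s (Finset.univ.image i) then 1 / ((s - 1).factorial : ℂ) else 0

/-- The `s`-clique spectral radius `μ_s(G)`. The value at `s = 0` is a convention. -/
noncomputable def cliqueSpectralRadius {V : Type*} [Fintype V] (G : SimpleGraph V) : ℕ → ℝ
  | 0 => 0
  | m + 1 => tensorSpectralRadius (cliqueTensor G (m + 1))

/-- The join `G ∨ H`: the disjoint union together with all edges between `G` and `H`. -/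
def graphJoin {V W : Type*} (G : SimpleGraph V) (H : SimpleGraph W) : SimpleGraph (V ⊕ W) :=
  (G ⊕g H) ⊔ completeBipartiteGraph V W

/-- The vertex set of `T_p(m)`: the disjoint union of `p` classes of sizes
`⌊(m + p - 1 - i) / p⌋`, `0 ≤ i < p`. For `p = 0` it is empty. -/
abbrev TuranVertex (p m : ℕ) : Type := (i : Fin p) × Fin ((m + (p - 1 - i)) / p)

/-- The complete `p`-partite graph `T_p(m)` on `m` vertices with class sizes as equal as possible.
For `p = 0` this is the graph without vertices (whereas `SimpleGraph.turanGraph m 0` is complete);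
for `p > 0` it is `SimpleGraph.turanGraph m p`, see `balancedPartite_iso_turanGraph`. -/
def balancedPartite (p m : ℕ) : SimpleGraph (TuranVertex p m) :=
  SimpleGraph.completeMultipartiteGraph fun i : Fin p => Fin ((m + (p - 1 - i)) / p)

theorem balancedPartite_iso_turanGraph (p m : ℕ) (hp : 0 < p) :
    Nonempty (balancedPartite p m ≃g SimpleGraph.turanGraph m p) := by
  have key : ∀ i < p, ∀ j, j < (m + (p - 1 - i)) / p ↔ j * p + i < m := by
    intro i hi j
    rw [Nat.lt_iff_add_one_le, Nat.le_div_iff_mul_le hp, Nat.add_mul]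
    omega
  refine ⟨⟨⟨fun v => ⟨v.2 * p + v.1, (key v.1 v.1.2 v.2).1 v.2.2⟩,
    fun w => ⟨⟨w % p, Nat.mod_lt _ hp⟩, ⟨w / p, (key _ (Nat.mod_lt _ hp) _).2 ?_⟩⟩, ?_, ?_⟩, ?_⟩⟩
  · rw [Nat.div_add_mod']; exact w.2
  · rintro ⟨⟨i, hi⟩, ⟨j, hj⟩⟩
    have h1 : (j * p + i) % p = i := by
      rw [Nat.add_comm, Nat.add_mul_mod_self_right, Nat.mod_eq_of_lt hi]
    have h2 : (j * p + i) / p = j := by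
      rw [Nat.add_comm, Nat.add_mul_div_right _ _ hp, Nat.div_eq_of_lt hi, Nat.zero_add]
    refine Sigma.ext (Fin.ext h1) ?_
    refine (Fin.heq_ext_iff ?_).2 h2
    simp only [h1]
  · intro w
    exact Fin.ext (Nat.div_add_mod' _ _)
  · rintro ⟨⟨i, hi⟩, ⟨j, hj⟩⟩ ⟨⟨i', hi'⟩, ⟨j', hj'⟩⟩
    simp [SimpleGraph.turanGraph_adj, balancedPartite, Nat.mod_eq_of_lt hi, Nat.mod_eq_of_lt hi',
      Nat.add_mod]

/-- The graph `K_{2k-2r+1} ∨ T_{2r-k-1}(n-2k+2r-1)`, for `r ≤ k ≤ 2r - 1` and `n ≥ k`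
(no subtraction is truncated in this range). -/
def extremalGraph (r k n : ℕ) :
    SimpleGraph (Fin (2 * k + 1 - 2 * r) ⊕
      TuranVertex (2 * r - 1 - k) (n - (2 * k + 1 - 2 * r))) :=
  graphJoin (⊤ : SimpleGraph (Fin (2 * k + 1 - 2 * r)))
    (balancedPartite (2 * r - 1 - k) (n - (2 * k + 1 - 2 * r)))

open Finset

/-! Write $p=2r-1-k$. In a $2K_r$-free graph two cliques with at least $r$ vertices each span at
most $2r-1$ vertices (`card_union_le_of_free`), so cliques of size at least $k$ overlap heavily. For
$p>0$ this gives two regimes.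

If there is a $(k+1)$-clique, every clique of size at least $k$ has at most $p-1$ vertices outside
it. If there is none, the sum collapses to $\mu_k$, and any two $k$-cliques share at least
$2k-2r+1=k-p$ vertices; when no $(k-p)$-set lies in all of them, a further count applies
(`card_intersecting_family_le`). In both situations there are only $O(n^{p-1})$ cliques, and the
crude bound $\mu_s\le|C_s|$ suffices: the extremal radius grows like $n^{p(k-1)/k}$, and
$p(k-1)/k>p-1$. The hypothesis on $n$ makes this comparison explicit (`bound_lt_prod_rpow`).

In the remaining case all $k$-cliques contain a fixed $(k-p)$-set $A$. Removing $A$ leaves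
$p$-cliques in a set without $(p+1)$-cliques, so Zykov's theorem bounds their number by that of
$T_p$, with equality only for the extremal graph (`card_cliquesIn_lt_or_iso`). The passage to the
spectral radius is $\mu_k\le|C_k|^{(k-1)/k}$ for graphs without $(k+1)$-cliques
(`cliqueSpectralRadius_le_card_rpow`), which follows from Hölder and a weighted Zykov theorem. An
explicit eigenvector of the extremal graph gives the matching lower bound
(`prod_rpow_le_cliqueSpectralRadius`).

For $k=2r-1$ there is at most one $k$-clique, and both sides are $0$ or $1$. -/

open Classical in
/-- The cliques with `s` vertices that are contained in `W`. -/
noncomputable def cliquesIn {V : Type*} (G : SimpleGraph V) (W : Finset V) (s : ℕ) :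
    Finset (Finset V) :=
  {C ∈ W.powersetCard s | G.IsClique C}

/-! ### Clique tensors and the clique polynomial -/

theorem mem_cliquesIn {V : Type*} {G : SimpleGraph V} {W : Finset V} {s : ℕ} {C : Finset V} :
    C ∈ cliquesIn G W s ↔ C ⊆ W ∧ #C = s ∧ G.IsClique C := by
  simp [cliquesIn, mem_powersetCard, and_assoc]

/-- Double counting: the factor $y_i$ restores the erased vertex, so each clique is counted once for
every vertex it has in `U`. With `U` everything this is Euler's identity for the clique polynomial;
the proof of Zykov's theorem uses a proper subset. -/
theorem sum_mul_sum_prod_erase {V R : Type*} [DecidableEq V] [CommSemiring R]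
    (𝒞 : Finset (Finset V)) (U : Finset V) (y : V → R) :
    ∑ i ∈ U, y i * ∑ C ∈ 𝒞 with i ∈ C, ∏ j ∈ C.erase i, y j
      = ∑ C ∈ 𝒞, (#(C ∩ U) : R) * ∏ j ∈ C, y j := by
  calc _ = ∑ i ∈ U, ∑ C ∈ 𝒞, if i ∈ C then ∏ j ∈ C, y j else 0 := by
        refine sum_congr rfl fun i _ => ?_
        rw [mul_sum, sum_filter]
        refine sum_congr rfl fun C _ => ?_
        split_ifs with h
        · exact mul_prod_erase C y h
        · rfl
    _ = _ := by
        rw [sum_comm]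
        refine sum_congr rfl fun C _ => ?_
        rw [← sum_filter, sum_const, nsmul_eq_mul, filter_mem_eq_inter, inter_comm]

theorem card_filter_image_eq {V : Type*} [Fintype V] [DecidableEq V] {m : ℕ} (E : Finset V)
    (hE : #E = m) : #{f : Fin m → V | univ.image f = E} = m.factorial := by
  have h1 : Fintype.card (Fin m ≃ E) = m.factorial := by
    rw [Fintype.card_equiv (E.equivFinOfCardEq hE).symm, Fintype.card_fin]
  rw [← h1, ← card_univ]
  symm
  refine card_bij (fun σ _ j => (σ j : V)) ?_ ?_ ?_
  · intro σ _
    simp only [mem_filter, mem_univ, true_and]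
    ext v
    simp only [mem_image, mem_univ, true_and]
    constructor
    · rintro ⟨j, rfl⟩; exact (σ j).2
    · intro hv; exact ⟨σ.symm ⟨v, hv⟩, by simp⟩
  · intro σ _ τ _ h
    ext j
    exact congrFun h j
  · intro f hf
    simp only [mem_filter, mem_univ, true_and] at hf
    have hinj : Set.InjOn f (univ : Finset (Fin m)) := by
      rw [← card_image_iff, hf, hE]; simp
    have hmem (j : Fin m) : f j ∈ E := hf ▸ mem_image_of_mem f (mem_univ j)
    refine ⟨Equiv.ofBijective (fun j => ⟨f j, hmem j⟩) ⟨fun a b hab => ?_, fun v => ?_⟩,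
      mem_univ _, rfl⟩
    · exact hinj (mem_univ a) (mem_univ b) (congrArg Subtype.val hab)
    · obtain ⟨j, -, hj⟩ := mem_image.1 (hf ▸ v.2 : (v : V) ∈ univ.image f)
      exact ⟨j, Subtype.ext hj⟩

/-- Grouping index tuples by their underlying set, each clique through `i` arises from $m!$ tuples,
which cancels the normalisation. The result is a partial derivative of the clique polynomial. -/
theorem tensorApply_cliqueTensor {V : Type*} [Fintype V] [DecidableEq V] (G : SimpleGraph V)
    {m : ℕ} (x : V → ℂ) (i : V) :
    tensorApply (cliqueTensor G (m + 1)) x i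
      = ∑ C ∈ cliquesIn G univ (m + 1) with i ∈ C, ∏ j ∈ C.erase i, x j := by
  obtain rfl : ‹DecidableEq V› = fun a b => Classical.propDecidable (a = b) :=
    Subsingleton.elim _ _
  classical
  have himg (f : Fin m → V) : univ.image (Fin.cons i f : Fin (m + 1) → V)
      = insert i (univ.image f) := by
    ext v
    simp [Fin.exists_fin_succ, eq_comm]
  simp only [tensorApply, cliqueTensor, ite_mul, zero_mul]
  rw [← sum_filter]
  rw [← sum_fiberwise_of_maps_to (t := {C ∈ cliquesIn G univ (m + 1) | i ∈ C})
    (g := fun f : Fin m → V => insert i (univ.image f))]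
  · refine sum_congr rfl fun C hC => ?_
    simp only [mem_filter, mem_cliquesIn, subset_univ, true_and] at hC
    obtain ⟨⟨hcard, hcl⟩, hi⟩ := hC
    have hE : #(C.erase i) = m := by rw [card_erase_of_mem hi, hcard]; rfl
    have hset : ({f ∈ {f : Fin m → V | G.IsNClique (m + 1)
        (univ.image (Fin.cons i f : Fin (m + 1) → V))} | insert i (univ.image f) = C}
          : Finset (Fin m → V)) = ({f : Fin m → V | univ.image f = C.erase i} : Finset _) := by
      ext f
      simp only [mem_filter, mem_univ, true_and, himg]
      constructor
      · rintro ⟨h1, h2⟩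
        rw [h2] at h1
        have : i ∉ univ.image f := by
          intro hmem
          rw [insert_eq_of_mem hmem] at h2
          have := card_image_le (s := (univ : Finset (Fin m))) (f := f)
          rw [h2, hcard] at this
          simp at this
        rw [← h2, erase_insert this]
      · intro h
        rw [h, insert_erase hi]
        exact ⟨⟨hcl, hcard⟩, rfl⟩
    rw [hset]
    have hconst : ∀ f ∈ ({f : Fin m → V | univ.image f = C.erase i} : Finset _),
        1 / ((m + 1 - 1).factorial : ℂ) * ∏ j, x (f j)
          = 1 / (m.factorial : ℂ) * ∏ j ∈ C.erase i, x j := by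
      intro f hf
      simp only [mem_filter, mem_univ, true_and] at hf
      have hinj : Set.InjOn f (univ : Finset (Fin m)) := by
        rw [← card_image_iff, hf, hE]; simp
      rw [← hf, prod_image hinj]
      simp
    rw [sum_congr rfl hconst, sum_const, card_filter_image_eq _ hE, nsmul_eq_mul]
    have : (m.factorial : ℂ) ≠ 0 := by exact_mod_cast m.factorial_ne_zero
    field_simp
  · intro f hf
    simp only [mem_filter, mem_univ, true_and, himg] at hf
    simp only [mem_filter, mem_cliquesIn, subset_univ, true_and]
    exact ⟨⟨hf.card_eq, hf.isClique⟩, mem_insert_self _ _⟩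

/-- Triangle inequality in each eigenvalue equation, then multiplication by $|x_i|$ and summation.
This reduces complex eigenvectors to nonnegative weights. -/
theorem norm_eigenvalue_mul_sum_le {V : Type*} [Fintype V] (G : SimpleGraph V) {m : ℕ} {l : ℂ}
    {x : V → ℂ} (h : ∀ i, tensorApply (cliqueTensor G (m + 1)) x i = l * x i ^ m) :
    ‖l‖ * ∑ i, ‖x i‖ ^ (m + 1)
      ≤ (m + 1) * ∑ C ∈ cliquesIn G univ (m + 1), ∏ j ∈ C, ‖x j‖ := by
  classical
  have h2 := sum_mul_sum_prod_erase (cliquesIn G univ (m + 1)) univ (fun i => ‖x i‖)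
  have h3 : ∑ C ∈ cliquesIn G univ (m + 1), (#(C ∩ univ) : ℝ) * ∏ j ∈ C, ‖x j‖
      = (m + 1) * ∑ C ∈ cliquesIn G univ (m + 1), ∏ j ∈ C, ‖x j‖ := by
    rw [mul_sum]
    refine sum_congr rfl fun C hC => ?_
    rw [inter_univ, (mem_cliquesIn.1 hC).2.1]
    push_cast; rfl
  rw [← h3, ← h2, mul_sum]
  refine sum_le_sum fun i _ => ?_
  calc ‖l‖ * ‖x i‖ ^ (m + 1) = ‖x i‖ * ‖l * x i ^ m‖ := by rw [norm_mul, norm_pow]; ring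
    _ ≤ _ := by
        rw [← h i, tensorApply_cliqueTensor]
        refine mul_le_mul_of_nonneg_left ((norm_sum_le _ _).trans ?_) (norm_nonneg _)
        simp [norm_prod]

theorem norm_eigenvalue_le {V : Type*} [Fintype V] (G : SimpleGraph V) {m : ℕ} {b : ℝ}
    (h : ∀ y : V → ℝ, (∀ i, 0 ≤ y i) → ((m + 1 : ℕ) : ℝ) *
      ∑ C ∈ cliquesIn G univ (m + 1), ∏ j ∈ C, y j ≤ b * ∑ i, y i ^ (m + 1))
    {l : ℂ} {x : V → ℂ} (hx : x ≠ 0)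
    (hl : ∀ i, tensorApply (cliqueTensor G (m + 1)) x i = l * x i ^ m) : ‖l‖ ≤ b := by
  have h1 := norm_eigenvalue_mul_sum_le G hl
  have h2 := h (fun i => ‖x i‖) (fun i => norm_nonneg _)
  push_cast at h2
  have h4 : 0 < ∑ i, ‖x i‖ ^ (m + 1) := by
    obtain ⟨i, hi⟩ := Function.ne_iff.1 hx
    exact sum_pos' (fun i _ => by positivity) ⟨i, mem_univ _, pow_pos (norm_pos_iff.2 hi) _⟩
  exact le_of_mul_le_mul_right (h1.trans h2) h4

/-- An upper bound for the clique polynomial bounds the clique spectral radius. -/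
theorem cliqueSpectralRadius_le {V : Type*} [Fintype V] (G : SimpleGraph V) (s : ℕ) (b : ℝ)
    (hb : 0 ≤ b)
    (h : ∀ y : V → ℝ, (∀ i, 0 ≤ y i) →
      s * ∑ C ∈ cliquesIn G univ s, ∏ j ∈ C, y j ≤ b * ∑ i, y i ^ s) :
    cliqueSpectralRadius G s ≤ b := by
  cases s with
  | zero => exact hb
  | succ m =>
    refine Real.sSup_le ?_ hb
    rintro t ⟨l, ⟨x, hx, hl⟩, rfl⟩
    exact norm_eigenvalue_le G h hx hl

theorem card_mul_prod_le_sum_pow {ι : Type*} (C : Finset ι) (y : ι → ℝ) (hy : ∀ i ∈ C, 0 ≤ y i) :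
    #C * ∏ j ∈ C, y j ≤ ∑ j ∈ C, y j ^ #C := by
  rcases Nat.eq_zero_or_pos #C with h0 | hpos
  · simp [card_eq_zero.1 h0]
  have hs : (#C : ℝ) ≠ 0 := by positivity
  have h := Real.geom_mean_le_arith_mean_weighted C (fun _ => (#C : ℝ)⁻¹) (fun j => y j ^ #C)
    (fun _ _ => by positivity) (by rw [sum_const, nsmul_eq_mul, mul_inv_cancel₀ hs])
    (fun j hj => pow_nonneg (hy j hj) _)
  rw [← mul_sum, prod_congr rfl fun j hj => Real.pow_rpow_inv_natCast (hy j hj) hpos.ne'] at h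
  rwa [← div_eq_inv_mul, le_div_iff₀ (by positivity), mul_comm] at h

theorem prod_le_sum_div_pow {ι : Type*} (C : Finset ι) (z : ι → ℝ) (hz : ∀ i ∈ C, 0 ≤ z i) :
    ∏ j ∈ C, z j ≤ ((∑ j ∈ C, z j) / #C) ^ #C := by
  rcases Nat.eq_zero_or_pos #C with h0 | hpos
  · simp [card_eq_zero.1 h0]
  have hs : (#C : ℝ) ≠ 0 := by positivity
  have h := Real.geom_mean_le_arith_mean_weighted C (fun _ => (#C : ℝ)⁻¹) z
    (fun _ _ => by positivity) (by rw [sum_const, nsmul_eq_mul, mul_inv_cancel₀ hs]) hz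
  rw [← mul_sum, ← div_eq_inv_mul] at h
  refine le_trans (le_of_eq ?_) (pow_le_pow_left₀
    (prod_nonneg fun j hj => Real.rpow_nonneg (hz j hj) _) h #C)
  rw [← prod_pow]
  exact prod_congr rfl fun j hj => (Real.rpow_inv_natCast_pow (hz j hj) hpos.ne').symm

/-- AM–GM on each clique separately, followed by enlarging each sum of powers to all vertices. -/
theorem mul_sum_prod_le_card_mul {V : Type*} [Fintype V] (G : SimpleGraph V) (s : ℕ)
    (y : V → ℝ) (hy : ∀ i, 0 ≤ y i) :
    s * ∑ C ∈ cliquesIn G univ s, ∏ j ∈ C, y j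
      ≤ #(cliquesIn G univ s) * ∑ i, y i ^ s := by
  rw [mul_sum, ← nsmul_eq_mul, ← sum_const]
  refine sum_le_sum fun C hC => ?_
  have h := card_mul_prod_le_sum_pow C y fun i _ => hy i
  rw [(mem_cliquesIn.1 hC).2.1] at h
  exact h.trans (sum_le_sum_of_subset_of_nonneg (subset_univ _) fun i _ _ => pow_nonneg (hy i) _)

theorem cliqueSpectralRadius_le_card {V : Type*} [Fintype V] (G : SimpleGraph V) (s : ℕ) :
    cliqueSpectralRadius G s ≤ #(cliquesIn G univ s) :=
  cliqueSpectralRadius_le G s _ (by positivity) (mul_sum_prod_le_card_mul G s)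

theorem cliqueSpectralRadius_nonneg {V : Type*} [Fintype V] (G : SimpleGraph V) (s : ℕ) :
    0 ≤ cliqueSpectralRadius G s := by
  cases s with
  | zero => exact le_rfl
  | succ m =>
    refine Real.sSup_nonneg ?_
    rintro t ⟨l, -, rfl⟩
    exact norm_nonneg l

theorem cliqueSpectralRadius_eq_zero {V : Type*} [Fintype V] (G : SimpleGraph V) {s : ℕ}
    (h : cliquesIn G univ s = ∅) : cliqueSpectralRadius G s = 0 :=
  le_antisymm (by simpa [h] using cliqueSpectralRadius_le_card G s)
    (cliqueSpectralRadius_nonneg G s)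

/-- The clique count bounds all eigenvalue moduli, so the supremum is a genuine one and not the
default value of `sSup`. -/
theorem norm_le_cliqueSpectralRadius {V : Type*} [Fintype V] (G : SimpleGraph V) {m : ℕ} {l : ℂ}
    (hl : IsTensorEigenvalue (cliqueTensor G (m + 1)) l) :
    ‖l‖ ≤ cliqueSpectralRadius G (m + 1) := by
  refine le_csSup ⟨#(cliquesIn G univ (m + 1)), ?_⟩ ⟨l, hl, rfl⟩
  rintro t ⟨l', ⟨x, hx, hl'⟩, rfl⟩
  exact norm_eigenvalue_le G (mul_sum_prod_le_card_mul G (m + 1)) hx hl'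

/-! ### Weighted Zykov theorem and the Motzkin–Straus bound -/

theorem insert_mem_cliquesIn {V : Type*} [DecidableEq V] {G : SimpleGraph V} {N W D : Finset V}
    {s : ℕ} {v : V} (hD : D ∈ cliquesIn G N s) (hNW : N ⊆ W) (hv : v ∈ W)
    (hadj : ∀ u ∈ D, G.Adj v u) : insert v D ∈ cliquesIn G W (s + 1) := by
  obtain ⟨h1, h2, h3⟩ := mem_cliquesIn.1 hD
  have hvD : v ∉ D := fun h => G.loopless.irrefl v (hadj v h)
  refine mem_cliquesIn.2 ⟨insert_subset hv (h1.trans hNW), by rw [card_insert_of_notMem hvD, h2],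
    ?_⟩
  rw [coe_insert]
  exact h3.insert fun u hu _ => hadj u hu

theorem erase_mem_cliquesIn {V : Type*} [DecidableEq V] {G : SimpleGraph V} {W C : Finset V}
    {s : ℕ} {v : V} (hC : C ∈ cliquesIn G W (s + 1)) (hv : v ∈ C) :
    C.erase v ∈ cliquesIn G W s := by
  obtain ⟨h1, h2, h3⟩ := mem_cliquesIn.1 hC
  refine mem_cliquesIn.2 ⟨(erase_subset _ _).trans h1, by rw [card_erase_of_mem hv, h2]; rfl, ?_⟩
  exact h3.subset (by exact_mod_cast erase_subset v C)

/-- Choose one vertex from every class, taking `w` in its own class. -/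
theorem exists_cliquesIn_of_complete_partite {V : Type*} [DecidableEq V] {G : SimpleGraph V}
    {N : Finset V} {p : ℕ} {c : V → ℕ} (hc : ∀ u ∈ N, c u < p)
    (hadj : ∀ u ∈ N, ∀ v ∈ N, G.Adj u v ↔ c u ≠ c v)
    (hne : ∀ j < p, ∃ v ∈ N, c v = j) {w : V} (hw : w ∈ N) :
    ∃ D ∈ cliquesIn G N p, w ∈ D := by
  have : ∀ j, ∃ v, j < p → v ∈ N ∧ c v = j ∧ (j = c w → v = w) := by
    intro j
    by_cases hj : j < p
    · by_cases hjw : j = c w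
      · exact ⟨w, fun _ => ⟨hw, hjw.symm, fun _ => rfl⟩⟩
      · obtain ⟨v, hv, hv'⟩ := hne j hj
        exact ⟨v, fun _ => ⟨hv, hv', fun h => absurd h hjw⟩⟩
    · exact ⟨w, fun h => absurd h hj⟩
  choose f hf using this
  have hinj : Set.InjOn f (range p) := by
    intro a ha b hb hab
    rw [coe_range, Set.mem_Iio] at ha hb
    rw [← (hf a ha).2.1, ← (hf b hb).2.1, hab]
  refine ⟨(range p).image f, mem_cliquesIn.2 ⟨?_, ?_, ?_⟩, ?_⟩
  · intro v hv
    obtain ⟨j, hj, rfl⟩ := mem_image.1 hv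
    exact (hf j (mem_range.1 hj)).1
  · rw [card_image_of_injOn hinj, card_range]
  · intro u hu v hv huv
    simp only [coe_image, coe_range, Set.mem_image, Set.mem_Iio] at hu hv
    obtain ⟨i, hi, rfl⟩ := hu
    obtain ⟨j, hj, rfl⟩ := hv
    rw [hadj _ (hf i hi).1 _ (hf j hj).1, (hf i hi).2.1, (hf j hj).2.1]
    rintro rfl
    exact huv rfl
  · exact mem_image.2 ⟨c w, mem_range.2 (hc w hw), (hf _ (hc w hw)).2.2 rfl⟩

/-- A weighted form of Zykov's theorem: the weighted number of `p`-cliques in a set `W` without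
`(p+1)`-cliques is at most that of a complete `p`-partite graph on `W`; equality holds only for
complete `p`-partite graphs. -/
theorem exists_partition_sum_prod_le {V : Type*} [DecidableEq V] (G : SimpleGraph V) (y : V → ℝ)
    (hy : ∀ v, 0 ≤ y v) (p : ℕ) (W : Finset V) (hW : cliquesIn G W (p + 1) = ∅) :
    ∃ c : V → ℕ, (∀ v ∈ W, c v < p) ∧
      ∑ C ∈ cliquesIn G W p, ∏ v ∈ C, y v ≤ ∏ j ∈ range p, ∑ v ∈ W with c v = j, y v ∧
      ((∀ v ∈ W, 0 < y v) → 0 < ∑ C ∈ cliquesIn G W p, ∏ v ∈ C, y v →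
        ∏ j ∈ range p, ∑ v ∈ W with c v = j, y v ≤ ∑ C ∈ cliquesIn G W p, ∏ v ∈ C, y v →
        ∀ u ∈ W, ∀ v ∈ W, G.Adj u v ↔ c u ≠ c v) := by
  induction p generalizing W with
  | zero =>
    have hWe : ∀ v, v ∉ W := by
      intro v hv
      have : ({v} : Finset V) ∈ cliquesIn G W (0 + 1) :=
        mem_cliquesIn.2 ⟨by simpa using hv, by simp, by simp⟩
      rw [hW] at this
      exact notMem_empty _ this
    refine ⟨fun _ => 0, fun v hv => absurd hv (hWe v), ?_, fun _ _ _ u hu => absurd hu (hWe u)⟩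
    have : cliquesIn G W 0 = {∅} := by
      ext C
      rw [mem_cliquesIn, mem_singleton]
      constructor
      · rintro ⟨-, h, -⟩; exact card_eq_zero.1 h
      · rintro rfl; simp
    simp [this]
  | succ p ih =>
    rcases W.eq_empty_or_nonempty with rfl | hne
    · refine ⟨fun _ => 0, by simp, ?_, by simp⟩
      have : cliquesIn G ∅ (p + 1) = ∅ := by
        refine eq_empty_of_forall_notMem fun C hC => ?_
        obtain ⟨h1, h2, -⟩ := mem_cliquesIn.1 hC
        rw [subset_empty.1 h1] at h2
        simp at h2
      simp [this]
    -- `d u` is the weighted clique degree. The induction runs on the neighbourhood `N` of a vertex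
    -- `v` of maximal degree; the non-neighbours `U` of `v` become the new class.
    set d : V → ℝ := fun u => ∑ C ∈ cliquesIn G W (p + 1) with u ∈ C, ∏ j ∈ C.erase u, y j with hd
    obtain ⟨v, hvW, hvmax⟩ := exists_max_image W d hne
    classical
    set N := {u ∈ W | G.Adj v u} with hN
    set U := {u ∈ W | ¬ G.Adj v u} with hU
    have hNW : N ⊆ W := filter_subset _ _
    have hUW : U ⊆ W := filter_subset _ _
    have hadjN : ∀ {u}, u ∈ N → G.Adj v u := fun h => (mem_filter.1 h).2
    have hNe : cliquesIn G N (p + 1) = ∅ := by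
      refine eq_empty_of_forall_notMem fun C hC => ?_
      have := insert_mem_cliquesIn hC hNW hvW fun u hu => hadjN ((mem_cliquesIn.1 hC).1 hu)
      rw [hW] at this
      exact notMem_empty _ this
    obtain ⟨c, hc, hle, heq⟩ := ih N hNe
    have hdv : d v = ∑ D ∈ cliquesIn G N p, ∏ j ∈ D, y j := by
      refine sum_nbij' (fun C => C.erase v) (fun D => insert v D) ?_ ?_ ?_ ?_ ?_
      · intro C hC
        obtain ⟨hC, hv⟩ := mem_filter.1 hC
        obtain ⟨h1, h2, h3⟩ := mem_cliquesIn.1 (erase_mem_cliquesIn hC hv)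
        refine mem_cliquesIn.2 ⟨fun u hu => mem_filter.2 ⟨h1 hu, ?_⟩, h2, h3⟩
        exact (mem_cliquesIn.1 hC).2.2 (by exact_mod_cast hv)
          (by exact_mod_cast mem_of_mem_erase hu) (ne_of_mem_erase hu).symm
      · intro D hD
        exact mem_filter.2 ⟨insert_mem_cliquesIn hD hNW hvW fun u hu =>
          hadjN ((mem_cliquesIn.1 hD).1 hu), mem_insert_self _ _⟩
      · intro C hC
        exact insert_erase (mem_filter.1 hC).2
      · intro D hD
        exact erase_insert fun h => G.loopless.irrefl v (hadjN ((mem_cliquesIn.1 hD).1 h))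
      · intro C hC
        rfl
    -- A $(p+1)$-clique avoiding `U` would lie in `N` and extend by `v` to a forbidden clique.
    have hmeet : ∀ C ∈ cliquesIn G W (p + 1), 1 ≤ #(C ∩ U) := by
      intro C hC
      by_contra hlt
      have h0 : C ∩ U = ∅ := by rw [← card_eq_zero]; omega
      have : C ∈ cliquesIn G N (p + 1) := by
        obtain ⟨h1, h2, h3⟩ := mem_cliquesIn.1 hC
        refine mem_cliquesIn.2 ⟨fun u hu => mem_filter.2 ⟨h1 hu, ?_⟩, h2, h3⟩
        by_contra hnu
        exact notMem_empty u (h0 ▸ mem_inter.2 ⟨hu, mem_filter.2 ⟨h1 hu, hnu⟩⟩)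
      rw [hNe] at this
      exact notMem_empty _ this
    have hprod0 : ∀ C : Finset V, 0 ≤ ∏ j ∈ C, y j := fun C => prod_nonneg fun j _ => hy j
    have hdouble := sum_mul_sum_prod_erase (cliquesIn G W (p + 1)) U y
    have h1 : ∑ C ∈ cliquesIn G W (p + 1), ∏ j ∈ C, y j ≤ ∑ u ∈ U, y u * d u := by
      rw [hdouble]
      refine sum_le_sum fun C hC => le_mul_of_one_le_left (hprod0 C) ?_
      exact_mod_cast hmeet C hC
    have h2 : ∑ u ∈ U, y u * d u ≤ (∑ u ∈ U, y u) * d v := by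
      rw [sum_mul]
      exact sum_le_sum fun u hu => mul_le_mul_of_nonneg_left (hvmax u (hUW hu)) (hy u)
    have hY0 : 0 ≤ ∑ u ∈ U, y u := sum_nonneg fun u _ => hy u
    have hNU : ∀ u ∈ W, u ∉ N → u ∈ U := fun u hu hn =>
      mem_filter.2 ⟨hu, fun h => hn (mem_filter.2 ⟨hu, h⟩)⟩
    have hUN : ∀ u ∈ U, u ∉ N := fun u hu hn => (mem_filter.1 hu).2 (hadjN hn)
    have hprod : ∏ j ∈ range (p + 1), ∑ u ∈ W with (if u ∈ N then c u else p) = j, y u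
        = (∏ j ∈ range p, ∑ u ∈ N with c u = j, y u) * ∑ u ∈ U, y u := by
      rw [prod_range_succ]
      congr 1
      · refine prod_congr rfl fun j hj => sum_congr ?_ fun _ _ => rfl
        ext u
        simp only [mem_filter]
        constructor
        · rintro ⟨hu, h⟩
          split_ifs at h with hn
          · exact ⟨hn, h⟩
          · rw [mem_range] at hj; omega
        · rintro ⟨hn, h⟩
          exact ⟨hNW hn, by rw [if_pos hn, h]⟩
      · refine sum_congr ?_ fun _ _ => rfl
        ext u
        simp only [mem_filter (s := W) (p := fun u => (if u ∈ N then c u else p) = p)]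
        constructor
        · rintro ⟨hu, h⟩
          refine hNU u hu fun hn => ?_
          rw [if_pos hn] at h
          exact (hc u hn).ne h
        · intro hu
          exact ⟨hUW hu, by rw [if_neg (hUN u hu)]⟩
    refine ⟨fun u => if u ∈ N then c u else p, ?_, ?_, ?_⟩
    · intro u _
      dsimp only
      split_ifs with hn
      · exact (hc u hn).trans (Nat.lt_succ_self p)
      · exact Nat.lt_succ_self p
    · rw [hprod, mul_comm]
      exact h1.trans (h2.trans (mul_le_mul_of_nonneg_left (hdv ▸ hle) hY0))
    · intro hpos hP hge
      rw [hprod] at hge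
      have hYd : 0 < (∑ u ∈ U, y u) * d v := hP.trans_le (h1.trans h2)
      have hd0 : 0 < d v := pos_of_mul_pos_right hYd hY0
      have hY : 0 < ∑ u ∈ U, y u := pos_of_mul_pos_left hYd hd0.le
      have hQ : ∏ j ∈ range p, ∑ u ∈ N with c u = j, y u ≤ d v := by
        refine le_of_mul_le_mul_right (hge.trans (h1.trans h2) |>.trans_eq (mul_comm _ _)) hY
      have hadj := heq (fun u hu => hpos u (hNW hu)) (hdv ▸ hd0) (hdv ▸ hQ)
      -- The whole chain of inequalities is now tight; each link is exploited in turn below.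
      have hP2 : (∑ u ∈ U, y u) * d v ≤ ∑ C ∈ cliquesIn G W (p + 1), ∏ j ∈ C, y j := by
        rw [mul_comm]
        exact (mul_le_mul_of_nonneg_right (hdv ▸ hle) hY0).trans hge
      have hdu : ∀ u ∈ U, d u = d v := by
        have hs : ∑ u ∈ U, y u * d u = ∑ u ∈ U, y u * d v := by
          rw [← sum_mul]
          exact le_antisymm h2 (hP2.trans h1)
        rw [sum_eq_sum_iff_of_le fun u hu =>
          mul_le_mul_of_nonneg_left (hvmax u (hUW hu)) (hy u)] at hs
        exact fun u hu => mul_left_cancel₀ (hpos u (hUW hu)).ne' (hs u hu)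
      have hprodpos : ∀ C ⊆ W, 0 < ∏ j ∈ C, y j := fun C hC => prod_pos fun j hj => hpos j (hC hj)
      have hone : ∀ C ∈ cliquesIn G W (p + 1), #(C ∩ U) = 1 := by
        have hs : ∑ C ∈ cliquesIn G W (p + 1), ∏ j ∈ C, y j
            = ∑ C ∈ cliquesIn G W (p + 1), (#(C ∩ U) : ℝ) * ∏ j ∈ C, y j := by
          rw [← hdouble]
          exact le_antisymm h1 (h2.trans hP2)
        rw [sum_eq_sum_iff_of_le fun C hC => le_mul_of_one_le_left (hprod0 C)
          (by exact_mod_cast hmeet C hC)] at hs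
        intro C hC
        have := hs C hC
        have hp := hprodpos C (mem_cliquesIn.1 hC).1
        have h1 : (#(C ∩ U) : ℝ) = 1 := by
          refine mul_right_cancel₀ hp.ne' ?_
          rw [← this, one_mul]
        exact_mod_cast h1
      -- Erasing `u` from the cliques through it gives $p$-cliques of `N` of total weight `d u = d
      -- v`, the full weight of such cliques. As weights are positive, none is missed.
      have hfull : ∀ u ∈ U, ∀ D ∈ cliquesIn G N p, ∀ w ∈ D, G.Adj u w := by
        intro u hu D hD w hw
        have hsub : ({C ∈ cliquesIn G W (p + 1) | u ∈ C}).image (fun C => C.erase u)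
            ⊆ cliquesIn G N p := by
          intro E hE
          obtain ⟨C, hC, rfl⟩ := mem_image.1 hE
          obtain ⟨hC, huC⟩ := mem_filter.1 hC
          obtain ⟨a1, a2, a3⟩ := mem_cliquesIn.1 (erase_mem_cliquesIn hC huC)
          refine mem_cliquesIn.2 ⟨fun z hz => ?_, a2, a3⟩
          by_contra hzN
          have hzU := hNU z (a1 hz) hzN
          have := card_le_one.1 (hone C hC).le z (mem_inter.2 ⟨mem_of_mem_erase hz, hzU⟩) u
            (mem_inter.2 ⟨huC, hu⟩)
          exact ne_of_mem_erase hz this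
        have hDI : D ∈ ({C ∈ cliquesIn G W (p + 1) | u ∈ C}).image (fun C => C.erase u) := by
          by_contra hDn
          have hlt := sum_lt_sum_of_subset hsub hD hDn
            (f := fun E => ∏ j ∈ E, y j) (hprodpos D ((mem_cliquesIn.1 hD).1.trans hNW))
            (fun E _ _ => hprod0 E)
          rw [sum_image, ← hdv, ← hdu u hu] at hlt
          · exact lt_irrefl _ hlt
          · intro C hC C' hC' h
            have hC := (mem_filter.1 (mem_coe.1 hC)).2
            have hC' := (mem_filter.1 (mem_coe.1 hC')).2
            rw [← insert_erase hC, ← insert_erase hC']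
            exact congrArg (insert u) h
        obtain ⟨C, hC, rfl⟩ := mem_image.1 hDI
        obtain ⟨hC, huC⟩ := mem_filter.1 hC
        exact (mem_cliquesIn.1 hC).2.2 (mem_coe.2 huC) (mem_coe.2 (mem_of_mem_erase hw))
          (ne_of_mem_erase hw).symm
      have hparts : ∀ j < p, ∃ u ∈ N, c u = j := by
        intro j hj
        by_contra hnone
        push Not at hnone
        have : ∏ j ∈ range p, ∑ u ∈ N with c u = j, y u = 0 := by
          refine prod_eq_zero (mem_range.2 hj) ?_
          rw [filter_false_of_mem hnone, sum_empty]
        rw [this, ← hdv] at hle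
        exact hd0.not_ge hle
      have hcross : ∀ u ∈ U, ∀ w ∈ N, G.Adj u w := by
        intro u hu w hw
        obtain ⟨D, hD, hwD⟩ := exists_cliquesIn_of_complete_partite hc hadj hparts hw
        exact hfull u hu D hD w hwD
      -- An edge inside `U` together with a $p$-clique of `N` would be a $(p+2)$-clique.
      have hindep : ∀ u ∈ U, ∀ w ∈ U, ¬ G.Adj u w := by
        intro u hu w hw huw
        have hDne : (cliquesIn G N p).Nonempty := by
          rw [nonempty_iff_ne_empty]
          intro h
          rw [hdv, h, sum_empty] at hd0
          exact lt_irrefl _ hd0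
        obtain ⟨D, hD⟩ := hDne
        have hw2 := insert_mem_cliquesIn hD hNW (hUW hw) (hfull w hw D hD)
        have hu2 := insert_mem_cliquesIn hw2 subset_rfl (hUW hu) (v := u) (by
          intro z hz
          rcases mem_insert.1 hz with rfl | hz
          · exact huw
          · exact hfull u hu D hD z hz)
        rw [hW] at hu2
        exact notMem_empty _ hu2
      intro u hu w hw
      dsimp only
      by_cases hun : u ∈ N <;> by_cases hwn : w ∈ N
      · rw [if_pos hun, if_pos hwn]
        exact hadj u hun w hwn
      · rw [if_pos hun, if_neg hwn]
        exact iff_of_true (hcross w (hNU w hw hwn) u hun).symm (hc u hun).ne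
      · rw [if_neg hun, if_pos hwn]
        exact iff_of_true (hcross u (hNU u hu hun) w hwn) (hc w hwn).ne'
      · rw [if_neg hun, if_neg hwn]
        exact iff_of_false (hindep u (hNU u hu hun) w (hNU w hw hwn)) (by simp)

/-- A Motzkin–Straus inequality for the number of `k`-cliques in a graph without
`(k+1)`-cliques. -/
theorem sum_prod_cliquesIn_le {V : Type*} [Fintype V] (G : SimpleGraph V) {k : ℕ}
    (hG : cliquesIn G univ (k + 1) = ∅) (y : V → ℝ) (hy : ∀ v, 0 ≤ y v) :
    ∑ C ∈ cliquesIn G univ k, ∏ v ∈ C, y v ≤ ((∑ v, y v) / k) ^ k := by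
  classical
  obtain ⟨c, hc, hle, -⟩ := exists_partition_sum_prod_le G y hy k univ hG
  refine hle.trans ((prod_le_sum_div_pow (range k) _ fun j _ => sum_nonneg fun v _ => hy v).trans
    (le_of_eq ?_))
  rw [card_range, sum_fiberwise_of_maps_to fun v hv => mem_range.2 (hc v hv)]

/-- Hölder with exponents $k/(k-1)$ and $k$ compares the clique polynomial with its value at the
weights $y_v^k$, where Motzkin–Straus applies. The factor $1/k$ there cancels the degree $k$
exactly. -/
theorem cliqueSpectralRadius_le_card_rpow {V : Type*} [Fintype V] (G : SimpleGraph V) {k : ℕ}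
    (hk : 2 ≤ k) (hG : cliquesIn G univ (k + 1) = ∅) :
    cliqueSpectralRadius G k ≤ (#(cliquesIn G univ k) : ℝ) ^ (((k : ℝ) - 1) / k) := by
  have hk0 : (0 : ℝ) < k := by positivity
  refine cliqueSpectralRadius_le G k _ (by positivity) fun y hy => ?_
  have hk1 : (1 : ℝ) < k := by exact_mod_cast hk
  have hconj : ((k : ℝ) / (k - 1)).HolderConjugate k := (Real.HolderConjugate.conjExponent hk1).symm
  have hH := Real.inner_le_Lp_mul_Lq_of_nonneg (cliquesIn G univ k) hconj (f := fun _ => 1)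
    (g := fun C => ∏ v ∈ C, y v) (fun _ _ => zero_le_one)
    (fun C _ => prod_nonneg fun v _ => hy v)
  simp only [one_mul, Real.one_rpow, sum_const, nsmul_eq_mul, mul_one, one_div_div,
    Real.rpow_natCast, ← prod_pow] at hH
  have hMS := sum_prod_cliquesIn_le G hG (fun v => y v ^ k) fun v => pow_nonneg (hy v) k
  have hS : 0 ≤ ∑ v, y v ^ k := sum_nonneg fun v _ => pow_nonneg (hy v) k
  have h2 : (∑ C ∈ cliquesIn G univ k, ∏ v ∈ C, y v ^ k) ^ (1 / (k : ℝ))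
      ≤ (∑ v, y v ^ k) / k := by
    refine (Real.rpow_le_rpow (sum_nonneg fun C _ => prod_nonneg fun v _ => pow_nonneg (hy v) k)
      hMS (by positivity)).trans (le_of_eq ?_)
    rw [one_div, Real.pow_rpow_inv_natCast (by positivity) (by omega)]
  calc (k : ℝ) * ∑ C ∈ cliquesIn G univ k, ∏ v ∈ C, y v
      ≤ k * ((#(cliquesIn G univ k) : ℝ) ^ (((k : ℝ) - 1) / k) * ((∑ v, y v ^ k) / k)) := by
        refine mul_le_mul_of_nonneg_left (hH.trans ?_) hk0.le
        exact mul_le_mul_of_nonneg_left h2 (by positivity)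
    _ = _ := by field_simp

/-! ### Lower bounds from explicit eigenvectors -/

/-- If the `k`-cliques of `G` are the transversals of `k` nonempty classes, then the clique
spectral radius is at least the expected one. -/
theorem prod_rpow_le_cliqueSpectralRadius {V ι : Type*} [Fintype V] [Fintype ι] [DecidableEq ι]
    (G : SimpleGraph V) {k : ℕ} (hk : 2 ≤ k) (hι : Fintype.card ι = k) (W : Finset V) (c : V → ι)
    (hC : ∀ C, C ∈ cliquesIn G univ k ↔ C ⊆ W ∧ #C = k ∧ Set.InjOn c C)
    (hne : ∀ j, 0 < #{v ∈ W | c v = j}) :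
    (∏ j, (#{v ∈ W | c v = j} : ℝ)) ^ (((k : ℝ) - 1) / k) ≤ cliqueSpectralRadius G k := by
  classical
  obtain ⟨m, rfl⟩ : ∃ m, k = m + 1 := ⟨k - 1, by omega⟩
  set M : ι → Finset V := fun j => {v ∈ W | c v = j} with hM
  set θ : ι → ℝ := fun j => (#(M j) : ℝ) ^ (((m + 1 : ℕ) : ℝ)⁻¹) with hθ
  have hθpos : ∀ j, 0 < θ j := fun j => Real.rpow_pos_of_pos (by exact_mod_cast hne j) _
  have hθpow : ∀ j, θ j ^ (m + 1) = #(M j) := fun j =>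
    Real.rpow_inv_natCast_pow (by positivity) (by omega)
  have hval : (∏ j, (#(M j) : ℝ)) ^ ((((m + 1 : ℕ) : ℝ) - 1) / (m + 1 : ℕ)) = ∏ j, θ j ^ m := by
    rw [← Real.finsetProd_rpow _ _ fun j _ => by positivity]
    refine prod_congr rfl fun j _ => ?_
    rw [hθ, ← Real.rpow_natCast, ← Real.rpow_mul (by positivity)]
    congr 1
    push_cast
    ring
  rw [hval]
  -- With value $|M_j|^{-1/k}$ on class $j$, the $k$-th powers of the entries sum to one over each
  -- class, the balance needed for an eigenvector.
  set x : V → ℂ := fun v => if v ∈ W then ((θ (c v) : ℝ) : ℂ)⁻¹ else 0 with hx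
  have hθne : ∀ j, ((θ j : ℝ) : ℂ) ≠ 0 := fun j => by exact_mod_cast (hθpos j).ne'
  have heig : IsTensorEigenvalue (cliqueTensor G (m + 1)) ((∏ j, θ j ^ m : ℝ) : ℂ) := by
    refine ⟨x, ?_, fun i => ?_⟩
    · have : Nonempty ι := Fintype.card_pos_iff.1 (by omega)
      obtain ⟨v, hv⟩ := card_pos.1 (hne (Classical.arbitrary ι))
      refine Function.ne_iff.2 ⟨v, ?_⟩
      simp only [hx, (mem_filter.1 hv).1, if_true]
      exact inv_ne_zero (hθne _)
    rw [tensorApply_cliqueTensor]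
    by_cases hi : i ∈ W
    swap
    · rw [filter_false_of_mem fun C hCm hiC => hi (((hC C).1 hCm).1 hiC)]
      simp only [hx, hi, if_false, sum_empty]
      rw [zero_pow (by omega), mul_zero]
    have himg : ∀ C ∈ cliquesIn G univ (m + 1), C.image c = univ := by
      intro C hCm
      obtain ⟨h1, h2, h3⟩ := (hC C).1 hCm
      rw [← card_eq_iff_eq_univ, card_image_of_injOn h3, h2, hι]
    have hterm : ∀ C ∈ {C ∈ cliquesIn G univ (m + 1) | i ∈ C},
        ∏ j ∈ C.erase i, x j = ∏ j ∈ univ.erase (c i), ((θ j : ℝ) : ℂ)⁻¹ := by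
      intro C hCm
      obtain ⟨hCm, hiC⟩ := mem_filter.1 hCm
      obtain ⟨h1, h2, h3⟩ := (hC C).1 hCm
      have : univ.erase (c i) = (C.erase i).image c := by
        rw [← himg C hCm]
        ext j
        simp only [mem_erase, mem_image]
        constructor
        · rintro ⟨hj, v, hv, rfl⟩
          exact ⟨v, ⟨fun h => hj (h ▸ rfl), hv⟩, rfl⟩
        · rintro ⟨v, ⟨hvi, hv⟩, rfl⟩
          exact ⟨fun h => hvi (h3 hv hiC h), v, hv, rfl⟩
      rw [this, prod_image (h3.mono (by exact_mod_cast erase_subset i C))]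
      refine prod_congr rfl fun v hv => ?_
      simp only [hx, h1 (mem_of_mem_erase hv), if_true]
    -- Cliques through `i` correspond to choice functions on the classes whose value at the class of
    -- `i` is `i`.
    have hcount : #{C ∈ cliquesIn G univ (m + 1) | i ∈ C} = ∏ j ∈ univ.erase (c i), #(M j) := by
      have : ∏ j ∈ univ.erase (c i), #(M j)
          = #(Fintype.piFinset fun j => if j = c i then {i} else M j) := by
        rw [Fintype.card_piFinset, ← mul_prod_erase univ _ (mem_univ (c i))]
        simp only [if_true, card_singleton, one_mul]
        exact prod_congr rfl fun j hj => by rw [if_neg (ne_of_mem_erase hj)]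
      rw [this]
      symm
      have hmemM : ∀ f ∈ Fintype.piFinset (fun j => if j = c i then {i} else M j),
          f (c i) = i ∧ ∀ j, f j ∈ W ∧ c (f j) = j := by
        intro f hf
        rw [Fintype.mem_piFinset] at hf
        have hci : f (c i) = i := by simpa using hf (c i)
        refine ⟨hci, fun j => ?_⟩
        by_cases hj : j = c i
        · rw [hj, hci]; exact ⟨hi, rfl⟩
        · have := hf j
          rw [if_neg hj] at this
          exact mem_filter.1 this
      refine card_bij (fun f _ => univ.image f) ?_ ?_ ?_
      · intro f hf
        obtain ⟨hci, hfj⟩ := hmemM f hf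
        have hinj : Function.Injective f := Function.LeftInverse.injective fun j => (hfj j).2
        refine mem_filter.2 ⟨(hC _).2 ⟨?_, ?_, ?_⟩, mem_image.2 ⟨c i, mem_univ _, hci⟩⟩
        · intro v hv
          obtain ⟨j, -, rfl⟩ := mem_image.1 hv
          exact (hfj j).1
        · rw [card_image_of_injective _ hinj, card_univ, hι]
        · intro u hu v hv huv
          simp only [coe_image, coe_univ, Set.image_univ, Set.mem_range] at hu hv
          obtain ⟨a, rfl⟩ := hu
          obtain ⟨b, rfl⟩ := hv
          rw [(hfj a).2, (hfj b).2] at huv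
          rw [huv]
      · intro f hf g hg hfg
        ext j
        have : f j ∈ univ.image g := hfg ▸ mem_image_of_mem f (mem_univ j)
        obtain ⟨b, -, hb⟩ := mem_image.1 this
        have hbj : b = j := by rw [← ((hmemM g hg).2 b).2, hb, ((hmemM f hf).2 j).2]
        rw [← hb, hbj]
      · intro C hCm
        obtain ⟨hCm, hiC⟩ := mem_filter.1 hCm
        obtain ⟨h1, h2, h3⟩ := (hC C).1 hCm
        have hex : ∀ j, ∃ v ∈ C, c v = j := fun j => by
          have := himg C hCm ▸ mem_univ j
          simpa using this
        choose f hfC hf using hex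
        refine ⟨f, ?_, ?_⟩
        · rw [Fintype.mem_piFinset]
          intro j
          split_ifs with hj
          · rw [mem_singleton]
            exact h3 (hfC j) hiC ((hf j).trans hj)
          · exact mem_filter.2 ⟨h1 (hfC j), hf j⟩
        · ext v
          rw [mem_image]
          constructor
          · rintro ⟨j, -, rfl⟩; exact hfC j
          · intro hv
            exact ⟨c v, mem_univ _, h3 (hfC _) hv (hf _)⟩
    rw [sum_congr rfl hterm, sum_const, hcount, nsmul_eq_mul]
    simp only [hx, hi, if_true]
    push_cast
    rw [← prod_mul_distrib, ← mul_prod_erase univ _ (mem_univ (c i)), mul_right_comm, ← mul_pow,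
      mul_inv_cancel₀ (hθne _), one_pow, one_mul]
    refine prod_congr rfl fun j _ => ?_
    have : ((#(M j) : ℕ) : ℂ) = (θ j : ℂ) ^ (m + 1) := by
      rw [← Complex.ofReal_pow, hθpow, Complex.ofReal_natCast]
    rw [this, pow_succ, mul_assoc, mul_inv_cancel₀ (hθne j), mul_one]
  have := norm_le_cliqueSpectralRadius G heig
  rwa [Complex.norm_real, Real.norm_of_nonneg (prod_nonneg fun j _ => by
    have := hθpos j; positivity)] at this

theorem one_le_cliqueSpectralRadius_of_unique {V : Type*} [Fintype V] (G : SimpleGraph V) {k : ℕ}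
    (hk : 2 ≤ k) (h : #(cliquesIn G univ k) = 1) : 1 ≤ cliqueSpectralRadius G k := by
  classical
  obtain ⟨C₀, hC₀⟩ := card_eq_one.1 h
  have hcard : #C₀ = k := (mem_cliquesIn.1 (hC₀ ▸ mem_singleton_self C₀)).2.1
  let e := C₀.equivFinOfCardEq hcard
  -- The value off `C₀` is irrelevant: the classes are only taken inside `C₀`, where they are
  -- singletons.
  let c : V → Fin k := fun v => if hv : v ∈ C₀ then e ⟨v, hv⟩ else ⟨0, by omega⟩
  have hinj : Set.InjOn c C₀ := by
    intro u hu v hv huv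
    simp only [c, dif_pos (mem_coe.1 hu), dif_pos (mem_coe.1 hv)] at huv
    exact congrArg Subtype.val (e.injective huv)
  have hone : ∀ j, #{v ∈ C₀ | c v = j} = 1 := by
    intro j
    rw [card_eq_one]
    refine ⟨(e.symm j : V), ?_⟩
    have hc : c (e.symm j) = j := by simp [c]
    ext v
    simp only [mem_filter, mem_singleton]
    constructor
    · rintro ⟨hv, hv'⟩
      exact hinj hv (e.symm j).2 (hv'.trans hc.symm)
    · rintro rfl
      exact ⟨(e.symm j).2, hc⟩
  have := prod_rpow_le_cliqueSpectralRadius G hk (Fintype.card_fin k) C₀ c (fun C => by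
    rw [hC₀, mem_singleton]
    constructor
    · rintro rfl; exact ⟨subset_rfl, hcard, hinj⟩
    · rintro ⟨h1, h2, -⟩; exact eq_of_subset_of_card_le h1 (by omega))
    (fun j => by rw [hone j]; exact one_pos)
  simpa [hone] using this

/-! ### Invariance under isomorphism -/

theorem isNClique_image_iso {V V' : Type*} [DecidableEq V] [DecidableEq V'] {G : SimpleGraph V}
    {H : SimpleGraph V'} (e : G ≃g H) (s : ℕ) (S : Finset V) :
    H.IsNClique s (S.image e) ↔ G.IsNClique s S := by
  rw [SimpleGraph.isNClique_iff, SimpleGraph.isNClique_iff, card_image_of_injective _ e.injective,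
    SimpleGraph.isClique_iff, SimpleGraph.isClique_iff, coe_image,
    (e.injective.injOn).pairwise_image]
  simp only [Set.Pairwise, Function.onFun, e.map_adj_iff]

theorem isTensorEigenvalue_of_iso {V V' : Type*} [Fintype V] [Fintype V'] {G : SimpleGraph V}
    {H : SimpleGraph V'} (e : G ≃g H) {m : ℕ} {l : ℂ}
    (h : IsTensorEigenvalue (cliqueTensor G (m + 1)) l) :
    IsTensorEigenvalue (cliqueTensor H (m + 1)) l := by
  classical
  obtain ⟨x, hx, hl⟩ := h
  refine ⟨x ∘ e.symm, ?_, fun i => ?_⟩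
  · obtain ⟨v, hv⟩ := Function.ne_iff.1 hx
    exact Function.ne_iff.2 ⟨e v, by simpa using hv⟩
  · rw [Function.comp_apply, ← hl (e.symm i)]
    unfold tensorApply
    refine (Fintype.sum_equiv (Equiv.arrowCongr (Equiv.refl (Fin m)) e.toEquiv) _ _ ?_).symm
    intro f
    have h1 : (Fin.cons i ((Equiv.arrowCongr (Equiv.refl (Fin m)) e.toEquiv) f) :
        Fin (m + 1) → V') = e ∘ (Fin.cons (e.symm i) f : Fin (m + 1) → V) := by
      ext j
      refine Fin.cases ?_ (fun j => ?_) j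
      · simp
      · simp
    have h2 : cliqueTensor H (m + 1) (e ∘ (Fin.cons (e.symm i) f : Fin (m + 1) → V))
        = cliqueTensor G (m + 1) (Fin.cons (e.symm i) f) := by
      unfold cliqueTensor
      have := isNClique_image_iso e (m + 1)
        (univ.image (Fin.cons (e.symm i) f : Fin (m + 1) → V))
      rw [image_image] at this
      refine if_congr ?_ rfl rfl
      convert this
    rw [h1, h2]
    congr 1
    simp

theorem cliqueSpectralRadius_congr {V V' : Type*} [Fintype V] [Fintype V'] {G : SimpleGraph V}
    {H : SimpleGraph V'} (e : G ≃g H) (s : ℕ) :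
    cliqueSpectralRadius G s = cliqueSpectralRadius H s := by
  cases s with
  | zero => rfl
  | succ m =>
    have : ∀ l, IsTensorEigenvalue (cliqueTensor G (m + 1)) l
        ↔ IsTensorEigenvalue (cliqueTensor H (m + 1)) l := fun l =>
      ⟨isTensorEigenvalue_of_iso e, isTensorEigenvalue_of_iso e.symm⟩
    simp only [cliqueSpectralRadius, tensorSpectralRadius, this]

/-! ### The extremal graph -/

/-- The class of a vertex of the extremal graph: a singleton or a class of `T_p(m)`. -/
abbrev extremalClass (r k n : ℕ) : (Fin (2 * k + 1 - 2 * r) ⊕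
      TuranVertex (2 * r - 1 - k) (n - (2 * k + 1 - 2 * r))) →
    Fin (2 * k + 1 - 2 * r) ⊕ Fin (2 * r - 1 - k) :=
  Sum.map id Sigma.fst

theorem extremalGraph_adj (r k n : ℕ) (u v) :
    (extremalGraph r k n).Adj u v ↔ extremalClass r k n u ≠ extremalClass r k n v := by
  rcases u with u | u <;> rcases v with v | v <;>
    simp [extremalGraph, graphJoin, balancedPartite, extremalClass]

/-- The extremal graph is complete multipartite, its clique part contributing singleton classes, so
cliques are partial transversals. -/
theorem mem_cliquesIn_extremalGraph (r k n s : ℕ) (C) :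
    C ∈ cliquesIn (extremalGraph r k n) univ s ↔
      C ⊆ univ ∧ #C = s ∧ Set.InjOn (extremalClass r k n) C := by
  rw [mem_cliquesIn]
  refine and_congr_right fun _ => and_congr_right fun _ => ?_
  rw [SimpleGraph.isClique_iff]
  constructor
  · intro h u hu v hv huv
    by_contra hne
    exact (extremalGraph_adj r k n u v).1 (h hu hv hne) huv
  · intro h u hu v hv huv
    exact (extremalGraph_adj r k n u v).2 fun heq => huv (h hu hv heq)

theorem cliquesIn_extremalGraph_eq_empty {r k n s : ℕ} (hrk : r ≤ k) (hkr : k ≤ 2 * r - 1)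
    (hr : 1 ≤ r) (hs : k < s) : cliquesIn (extremalGraph r k n) univ s = ∅ := by
  classical
  refine eq_empty_of_forall_notMem fun C hC => ?_
  obtain ⟨-, h2, h3⟩ := (mem_cliquesIn_extremalGraph r k n s C).1 hC
  have := card_le_univ (C.image (extremalClass r k n))
  rw [card_image_of_injOn h3, h2, Fintype.card_sum, Fintype.card_fin, Fintype.card_fin] at this
  omega

theorem extremalGraph_lower {r k n : ℕ} (hr : 3 ≤ r) (hrk : r ≤ k) (hkr : k ≤ 2 * r - 1)
    (hn : k ≤ n) :
    (∏ j : Fin (2 * r - 1 - k), (((n - (2 * k + 1 - 2 * r) + (2 * r - 1 - k - 1 - j))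
      / (2 * r - 1 - k) : ℕ) : ℝ)) ^ (((k : ℝ) - 1) / k)
      ≤ cliqueSpectralRadius (extremalGraph r k n) k := by
  classical
  have hl : ∀ j, #{v ∈ (univ : Finset (Fin (2 * k + 1 - 2 * r) ⊕
      TuranVertex (2 * r - 1 - k) (n - (2 * k + 1 - 2 * r)))) | extremalClass r k n v = Sum.inl j}
        = 1 := by
    intro j
    rw [card_eq_one]
    refine ⟨Sum.inl j, ?_⟩
    ext v
    rcases v with v | v <;> simp [extremalClass]
  have hrt : ∀ j, #{v ∈ (univ : Finset (Fin (2 * k + 1 - 2 * r) ⊕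
      TuranVertex (2 * r - 1 - k) (n - (2 * k + 1 - 2 * r)))) | extremalClass r k n v = Sum.inr j}
        = (n - (2 * k + 1 - 2 * r) + (2 * r - 1 - k - 1 - j)) / (2 * r - 1 - k) := by
    intro j
    rw [← Fintype.card_fin ((n - (2 * k + 1 - 2 * r) + (2 * r - 1 - k - 1 - j)) / (2 * r - 1 - k)),
      ← card_univ]
    symm
    refine card_bij (fun t _ => Sum.inr ⟨j, t⟩) ?_ ?_ ?_
    · intro t _
      simp [extremalClass]
    · intro t _ t' _ h
      simpa using h
    · rintro (v | ⟨j', t⟩) hv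
      · simp [extremalClass] at hv
      · have : j' = j := by simpa [extremalClass] using hv
        subst this
        exact ⟨t, mem_univ _, rfl⟩
  have := prod_rpow_le_cliqueSpectralRadius (extremalGraph r k n) (k := k) (by omega)
    (ι := Fin (2 * k + 1 - 2 * r) ⊕ Fin (2 * r - 1 - k))
    (by rw [Fintype.card_sum, Fintype.card_fin, Fintype.card_fin]; omega) univ
    (extremalClass r k n) (mem_cliquesIn_extremalGraph r k n k) (by
      rintro (j | j)
      · rw [hl]; exact one_pos
      · rw [hrt]
        have := j.2
        -- Every Turán class is nonempty because $n\ge k$ leaves at least $2r-1-k$ vertices for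
        -- them.
        exact Nat.div_pos (by omega) (by omega))
  rw [Fintype.prod_sum_type] at this
  simpa only [hl, hrt, Nat.cast_one, prod_const_one, one_mul] using this

/-! ### Balanced products and the equality case of Zykov's theorem -/

/-- The convex function $q(1+1/q)^{w-q}$ meets the line $w$ exactly at $q$ and $q+1$, hence lies
above it at all other integers. Multiplying such bounds turns a product into a power of the sum. -/
theorem mul_one_add_inv_pow_le {q : ℕ} (hq : 0 < q) (w : ℕ) :
    (w : ℝ) * (1 + 1 / q) ^ q ≤ q * (1 + 1 / q) ^ w ∧
      (w ≠ q → w ≠ q + 1 → (w : ℝ) * (1 + 1 / q) ^ q < q * (1 + 1 / q) ^ w) ∧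
      (w = q ∨ w = q + 1 → (w : ℝ) * (1 + 1 / q) ^ q = q * (1 + 1 / q) ^ w) := by
  have hq' : (0 : ℝ) < q := by exact_mod_cast hq
  have heq : w = q ∨ w = q + 1 → (w : ℝ) * (1 + 1 / q) ^ q = q * (1 + 1 / q) ^ w := by
    rintro (rfl | rfl)
    · rfl
    · push_cast
      rw [pow_succ]
      field_simp
  have hlt : w ≠ q → w ≠ q + 1 → (w : ℝ) * (1 + 1 / q) ^ q < q * (1 + 1 / q) ^ w := by
    intro h1 h2
    rcases lt_or_gt_of_ne h1 with h | h
    · obtain ⟨t, rfl⟩ := Nat.exists_eq_add_of_lt h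
      -- Bernoulli bounds $w/Q$ by $(1-1/Q)^{t+1}$; strictness comes from $(1-1/Q)(1+1/Q)<1$.
      have hb := one_add_mul_le_pow (a := -(1 / ((w + t + 1 : ℕ) : ℝ))) (by
        have : 1 / ((w + t + 1 : ℕ) : ℝ) ≤ 1 := by
          rw [div_le_one hq']
          exact_mod_cast hq
        linarith) (t + 1)
      set Q : ℝ := ((w + t + 1 : ℕ) : ℝ) with hQ
      have hwQ : (w : ℝ) = Q * (1 + ((t + 1 : ℕ) : ℝ) * -(1 / Q)) := by
        rw [hQ]; push_cast; field_simp; ring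
      have hlt1 : ((1 + -(1 / Q)) * (1 + 1 / Q)) ^ (t + 1) < 1 := by
        refine pow_lt_one₀ ?_ ?_ (by omega)
        · have : 1 / Q ≤ 1 := by
            rw [div_le_one hq', hQ]
            exact_mod_cast hq
          have h0 : 0 < 1 / Q := by positivity
          exact mul_nonneg (by linarith) (by linarith)
        · have h0 : 0 < 1 / Q := by positivity
          nlinarith
      have hexp : (1 + 1 / Q) ^ (w + t + 1) = (1 + 1 / Q) ^ w * (1 + 1 / Q) ^ (t + 1) := by
        rw [← pow_add, add_assoc]
      rw [hexp]
      have hpos : 0 < (1 + 1 / Q) ^ w := by positivity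
      calc (w : ℝ) * ((1 + 1 / Q) ^ w * (1 + 1 / Q) ^ (t + 1))
          ≤ (Q * (1 + -(1 / Q)) ^ (t + 1)) * ((1 + 1 / Q) ^ w * (1 + 1 / Q) ^ (t + 1)) := by
            refine mul_le_mul_of_nonneg_right ?_ (by positivity)
            rw [hwQ]
            exact mul_le_mul_of_nonneg_left hb hq'.le
        _ = Q * (1 + 1 / Q) ^ w * ((1 + -(1 / Q)) * (1 + 1 / Q)) ^ (t + 1) := by
            rw [mul_pow]; ring
        _ < Q * (1 + 1 / Q) ^ w * 1 := mul_lt_mul_of_pos_left hlt1 (by positivity)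
        _ = _ := mul_one _
    · obtain ⟨t, rfl⟩ : ∃ t, w = q + 1 + (t + 1) := ⟨w - q - 2, by omega⟩
      have hb := one_add_mul_le_pow (a := 1 / (q : ℝ)) (by
        have : 0 < 1 / (q : ℝ) := by positivity
        linarith) (t + 1)
      have h3 : ((q + 1 + (t + 1) : ℕ) : ℝ)
          < q * ((1 + 1 / q) * (1 + ((t + 1 : ℕ) : ℝ) * (1 / q))) := by
        push_cast
        have : (q : ℝ) * ((1 + 1 / q) * (1 + ((t : ℝ) + 1) * (1 / q)))
          = q + 1 + (t + 1) + (t + 1) / q := by field_simp; ring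
        rw [this]
        have : 0 < ((t : ℝ) + 1) / q := by positivity
        linarith
      have hpos : 0 < (1 + 1 / (q : ℝ)) ^ q := by positivity
      calc ((q + 1 + (t + 1) : ℕ) : ℝ) * (1 + 1 / q) ^ q
          < q * ((1 + 1 / q) * (1 + ((t + 1 : ℕ) : ℝ) * (1 / q))) * (1 + 1 / q) ^ q :=
            mul_lt_mul_of_pos_right h3 hpos
        _ ≤ q * ((1 + 1 / q) * (1 + 1 / q) ^ (t + 1)) * (1 + 1 / q) ^ q := by gcongr
        _ = _ := by rw [pow_add, pow_add]; ring
  refine ⟨?_, hlt, heq⟩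
  by_cases h : w = q ∨ w = q + 1
  · exact (heq h).le
  · push Not at h
    exact (hlt h.1 h.2).le

theorem sum_balanced (p m : ℕ) (hp : 0 < p) : ∑ j ∈ range p, (m + (p - 1 - j)) / p = m := by
  obtain ⟨e⟩ := balancedPartite_iso_turanGraph p m hp
  have := Fintype.card_congr e.toEquiv
  rw [Fintype.card_sigma, Fintype.card_fin] at this
  simp only [Fintype.card_fin] at this
  rw [← this, sum_range]
  simp [this]

theorem balanced_eq (p m j : ℕ) (hj : j < p) :
    (m + (p - 1 - j)) / p = m / p ∨ (m + (p - 1 - j)) / p = m / p + 1 := by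
  have hp : 0 < p := by omega
  have h1 : m / p ≤ (m + (p - 1 - j)) / p := Nat.div_le_div_right (by omega)
  have h2 : (m + (p - 1 - j)) / p ≤ (m + p) / p := Nat.div_le_div_right (by omega)
  rw [Nat.add_div_right _ hp] at h2
  omega

/-- Among `p` natural numbers with sum at most `m`, the product is largest for balanced ones. -/
theorem prod_le_prod_balanced {p m : ℕ} (hp : 0 < p) (hpm : p ≤ m) (w : ℕ → ℕ)
    (hw : ∑ j ∈ range p, w j ≤ m) :
    ∏ j ∈ range p, w j ≤ ∏ j ∈ range p, (m + (p - 1 - j)) / p ∧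
      (∏ j ∈ range p, (m + (p - 1 - j)) / p ≤ ∏ j ∈ range p, w j →
        ∑ j ∈ range p, w j = m ∧ ∀ j < p, w j = m / p ∨ w j = m / p + 1) := by
  set q := m / p with hqdef
  have hq : 0 < q := Nat.div_pos hpm hp
  have hq' : (0 : ℝ) < q := by exact_mod_cast hq
  set β : ℝ := 1 + 1 / q with hβ
  have hβ1 : 1 < β := by
    have : 0 < 1 / (q : ℝ) := by positivity
    linarith
  have hβ0 : 0 < β := by linarith
  -- The balanced sizes are all $q$ or $q+1$, where the exponential bound is an equality; this is
  -- the benchmark for arbitrary sizes.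
  have hg : (∏ j ∈ range p, (((m + (p - 1 - j)) / p : ℕ) : ℝ)) * (β ^ q) ^ p
      = (q : ℝ) ^ p * β ^ m := by
    calc _ = ∏ j ∈ range p, ((((m + (p - 1 - j)) / p : ℕ) : ℝ) * β ^ q) := by
          rw [prod_mul_distrib, prod_const, card_range]
      _ = ∏ j ∈ range p, ((q : ℝ) * β ^ ((m + (p - 1 - j)) / p)) :=
          prod_congr rfl fun j hj =>
            (mul_one_add_inv_pow_le hq _).2.2 (balanced_eq p m j (mem_range.1 hj))
      _ = _ := by
          rw [prod_mul_distrib, prod_const, card_range, prod_pow_eq_pow_sum, sum_balanced p m hp]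
  have hsplit : (∏ j ∈ range p, (w j : ℝ)) * (β ^ q) ^ p = ∏ j ∈ range p, ((w j : ℝ) * β ^ q) := by
    rw [prod_mul_distrib, prod_const, card_range]
  have hsplit2 : ∏ j ∈ range p, ((q : ℝ) * β ^ w j) = (q : ℝ) ^ p * β ^ ∑ j ∈ range p, w j := by
    rw [prod_mul_distrib, prod_const, card_range, prod_pow_eq_pow_sum]
  have h1 : ∏ j ∈ range p, ((w j : ℝ) * β ^ q) ≤ ∏ j ∈ range p, ((q : ℝ) * β ^ w j) :=
    prod_le_prod (fun j _ => by positivity) fun j _ => (mul_one_add_inv_pow_le hq _).1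
  have h2 : (q : ℝ) ^ p * β ^ ∑ j ∈ range p, w j ≤ (q : ℝ) ^ p * β ^ m :=
    mul_le_mul_of_nonneg_left (pow_le_pow_right₀ hβ1.le hw) (by positivity)
  have hpw : 0 < (β ^ q) ^ p := by positivity
  refine ⟨?_, fun hge => ?_⟩
  · have : (∏ j ∈ range p, (w j : ℝ)) ≤ ∏ j ∈ range p, (((m + (p - 1 - j)) / p : ℕ) : ℝ) := by
      refine le_of_mul_le_mul_right ?_ hpw
      rw [hg, hsplit]
      exact h1.trans (hsplit2 ▸ h2)
    exact_mod_cast this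
  · have hge' : (∏ j ∈ range p, (((m + (p - 1 - j)) / p : ℕ) : ℝ)) ≤ ∏ j ∈ range p, (w j : ℝ) := by
      exact_mod_cast hge
    have h3 : (q : ℝ) ^ p * β ^ m ≤ ∏ j ∈ range p, ((w j : ℝ) * β ^ q) := by
      rw [← hg, ← hsplit]
      exact mul_le_mul_of_nonneg_right hge' hpw.le
    have hgpos : 0 < ∏ j ∈ range p, w j := by
      refine lt_of_lt_of_le (prod_pos fun j hj => ?_) hge
      rcases balanced_eq p m j (mem_range.1 hj) with h | h <;> omega
    have hwpos : ∀ j ∈ range p, 0 < w j := fun j hj =>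
      Nat.pos_of_ne_zero fun h => hgpos.ne' (prod_eq_zero hj h)
    constructor
    · refine le_antisymm hw ?_
      have : (q : ℝ) ^ p * β ^ m ≤ (q : ℝ) ^ p * β ^ ∑ j ∈ range p, w j :=
        h3.trans (hsplit2 ▸ h1)
      exact (pow_le_pow_iff_right₀ hβ1).1 (le_of_mul_le_mul_left this (by positivity))
    · intro j hj
      by_contra hcon
      push Not at hcon
      have hlt : ∏ j ∈ range p, ((w j : ℝ) * β ^ q) < ∏ j ∈ range p, ((q : ℝ) * β ^ w j) := by
        refine prod_lt_prod (fun i hi => ?_) (fun i _ => (mul_one_add_inv_pow_le hq _).1)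
          ⟨j, mem_range.2 hj, (mul_one_add_inv_pow_le hq _).2.1 hcon.1 hcon.2⟩
        have : (0 : ℝ) < w i := by exact_mod_cast hwpos i hi
        positivity
      rw [hsplit2] at hlt
      exact absurd (h3.trans_lt (hlt.trans_le h2)) (lt_irrefl _)

/-- Zykov's theorem for `p`-cliques in a set of at most `m` vertices without `(p+1)`-cliques, with
the case of equality. -/
theorem card_cliquesIn_le_balanced {V : Type*} [DecidableEq V] (G : SimpleGraph V) {p m : ℕ}
    (hp : 0 < p) (hpm : p ≤ m) (W : Finset V) (hWm : #W ≤ m)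
    (hW : cliquesIn G W (p + 1) = ∅) :
    #(cliquesIn G W p) ≤ ∏ j ∈ range p, (m + (p - 1 - j)) / p ∧
      (∏ j ∈ range p, (m + (p - 1 - j)) / p ≤ #(cliquesIn G W p) →
        #W = m ∧ ∃ c : V → ℕ, (∀ v ∈ W, c v < p) ∧
          (∀ u ∈ W, ∀ v ∈ W, G.Adj u v ↔ c u ≠ c v) ∧
          ∀ j < p, #{v ∈ W | c v = j} = m / p ∨ #{v ∈ W | c v = j} = m / p + 1) := by
  obtain ⟨c, hc, hle, heq⟩ :=
    exists_partition_sum_prod_le G (fun _ => 1) (fun _ => zero_le_one) p W hW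
  simp only [prod_const_one, sum_const, nsmul_eq_mul, mul_one] at hle heq
  have hle' : #(cliquesIn G W p) ≤ ∏ j ∈ range p, #{v ∈ W | c v = j} := by exact_mod_cast hle
  have hsum : ∑ j ∈ range p, #{v ∈ W | c v = j} = #W :=
    (card_eq_sum_card_fiberwise fun v hv => mem_coe.2 (mem_range.2 (hc v hv))).symm
  obtain ⟨hb, hbe⟩ := prod_le_prod_balanced hp hpm (fun j => #{v ∈ W | c v = j})
    (hsum.trans_le hWm)
  refine ⟨hle'.trans hb, fun hge => ?_⟩
  obtain ⟨h1, h2⟩ := hbe (hge.trans hle')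
  refine ⟨hsum ▸ h1, c, hc, heq (fun _ _ => one_pos) ?_ ?_, h2⟩
  · have : 0 < #(cliquesIn G W p) := by
      refine lt_of_lt_of_le (prod_pos fun j hj => ?_) hge
      have := Nat.div_pos hpm hp
      rcases balanced_eq p m j (mem_range.1 hj) with h | h <;> omega
    exact_mod_cast this
  · exact_mod_cast hb.trans hge

/-- The level sets of `c` form an equipartition into $p$ parts, and `exists_partPreservingEquiv`
numbers its vertices so that parts become residue classes modulo $p$. -/
theorem iso_turanGraph_of_balanced {α : Type*} [Fintype α] [DecidableEq α] (H : SimpleGraph α)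
    {p m : ℕ} (hp : 0 < p) (hpm : p ≤ m) (hcard : Fintype.card α = m) (c : α → ℕ)
    (hc : ∀ v, c v < p) (hadj : ∀ u v, H.Adj u v ↔ c u ≠ c v)
    (hbal : ∀ j < p, #{v | c v = j} = m / p ∨ #{v | c v = j} = m / p + 1) :
    Nonempty (H ≃g SimpleGraph.turanGraph m p) := by
  classical
  subst hcard
  let P : Finpartition (univ : Finset α) := Finpartition.ofSetoid (Setoid.comap c ⊥)
  have hpart (u v : α) : u ∈ P.part v ↔ c v = c u :=
    Finpartition.mem_part_ofSetoid_iff_rel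
  have hpart' (v : α) : P.part v = ({u | c u = c v} : Finset α) := by
    ext u
    rw [hpart, mem_filter]
    simp [eq_comm]
  have hparts : P.parts = (range p).image fun j => ({v | c v = j} : Finset α) := by
    ext S
    rw [mem_image]
    constructor
    · intro hS
      obtain ⟨v, hv⟩ := P.nonempty_of_mem_parts hS
      refine ⟨c v, mem_range.2 (hc v), ?_⟩
      rw [← hpart', P.part_eq_of_mem hS hv]
    · rintro ⟨j, hj, rfl⟩
      have hpos : 0 < #({v | c v = j} : Finset α) := by
        have := Nat.div_pos hpm hp
        rcases hbal j (mem_range.1 hj) with h | h <;> omega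
      obtain ⟨v, hv⟩ := card_pos.1 hpos
      obtain rfl : c v = j := by simpa using hv
      rw [← hpart']
      exact P.part_mem.2 (mem_univ v)
  have hcardparts : #P.parts = p := by
    rw [hparts, card_image_of_injOn, card_range]
    intro i hi j hj hij
    have hpos : 0 < #({v | c v = i} : Finset α) := by
      have := Nat.div_pos hpm hp
      rcases hbal i (by simpa using hi) with h | h <;> omega
    obtain ⟨v, hv⟩ := card_pos.1 hpos
    have hv' : v ∈ ({v | c v = j} : Finset α) := by
      have hij' : ({v | c v = i} : Finset α) = ({v | c v = j} : Finset α) := hij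
      rwa [hij'] at hv
    rw [← (mem_filter.1 hv).2, (mem_filter.1 hv').2]
  have heq : P.IsEquipartition := by
    rw [Finpartition.isEquipartition_iff_card_parts_eq_average]
    intro S hS
    rw [hparts] at hS
    obtain ⟨j, hj, rfl⟩ := mem_image.1 hS
    rw [hcardparts, card_univ]
    exact hbal j (mem_range.1 hj)
  obtain ⟨f, hf⟩ := heq.exists_partPreservingEquiv
  rw [hcardparts] at hf
  refine ⟨⟨(Equiv.subtypeUnivEquiv mem_univ).symm.trans
    (f.trans (finCongr (card_univ (α := α)))), ?_⟩⟩
  intro u v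
  have := hf ⟨u, mem_univ u⟩ ⟨v, mem_univ v⟩
  have hpp : P.part u = P.part v ↔ c u = c v := by
    rw [hpart', hpart']
    constructor
    · intro h
      have : u ∈ ({w | c w = c v} : Finset α) := h ▸ by simp
      simpa using this
    · intro h
      rw [h]
  rw [SimpleGraph.turanGraph_adj, hadj]
  simp only [Equiv.trans_apply, Equiv.subtypeUnivEquiv_symm_apply, finCongr_apply, Fin.val_cast]
  rw [ne_eq, ne_eq, ← this, hpp]

/-! ### Counting large cliques in a $2K_r$-free graph -/

/-- A union with $2r$ vertices would contain disjoint $r$-sets, one in each clique: fill the first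
from `F \ B` as far as possible, so that enough of `B` remains for the second. -/
theorem card_union_le_of_free {V : Type*} [DecidableEq V] {G : SimpleGraph V} {r : ℕ} (hr : 1 ≤ r)
    (hfree : SimpleGraph.Free ((⊤ : SimpleGraph (Fin r)) ⊕g (⊤ : SimpleGraph (Fin r))) G)
    {F B : Finset V} (hF : G.IsClique F) (hB : G.IsClique B) (hFr : r ≤ #F) (hBr : r ≤ #B) :
    #(F ∪ B) ≤ 2 * r - 1 := by
  by_contra hcon
  obtain ⟨X, Y, hXF, hYB, hX, hY, hXY⟩ : ∃ X Y : Finset V, X ⊆ F ∧ Y ⊆ B ∧ #X = r ∧ #Y = r ∧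
      Disjoint X Y := by
    have hFB : #(F \ B) + #B = #(F ∪ B) := card_sdiff_add_card F B
    by_cases h : r ≤ #(F \ B)
    · obtain ⟨X, hX, hXr⟩ := exists_subset_card_eq h
      obtain ⟨Y, hY, hYr⟩ := exists_subset_card_eq hBr
      exact ⟨X, Y, hX.trans sdiff_subset, hY, hXr, hYr,
        disjoint_of_subset_left hX (disjoint_of_subset_right hY sdiff_disjoint)⟩
    · obtain ⟨X, hX1, hX2, hXr⟩ :=
        exists_subsuperset_card_eq (sdiff_subset : F \ B ⊆ F) (by omega) hFr
      have h1 : #(F ∪ B) ≤ #(B \ X) + #X := by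
        rw [card_sdiff_add_card]
        refine card_le_card fun v hv => ?_
        rw [mem_union] at hv ⊢
        by_cases hvB : v ∈ B
        · exact Or.inl hvB
        · exact Or.inr (hX1 (mem_sdiff.2 ⟨hv.resolve_right hvB, hvB⟩))
      obtain ⟨Y, hY, hYr⟩ := exists_subset_card_eq (show r ≤ #(B \ X) by omega)
      exact ⟨X, Y, hX2, hY.trans sdiff_subset, hXr, hYr,
        (disjoint_of_subset_left hY sdiff_disjoint).symm⟩
  let eX := X.equivFinOfCardEq hX
  let eY := Y.equivFinOfCardEq hY
  refine hfree ⟨⟨⟨Sum.elim (fun i => (eX.symm i : V)) (fun i => (eY.symm i : V)), ?_⟩, ?_⟩⟩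
  · rintro (i | i) (j | j) hij
    · refine hF (hXF (eX.symm i).2) (hXF (eX.symm j).2) fun h => ?_
      have : i = j := eX.symm.injective (Subtype.ext h)
      simp [this] at hij
    · simp at hij
    · simp at hij
    · refine hB (hYB (eY.symm i).2) (hYB (eY.symm j).2) fun h => ?_
      have : i = j := eY.symm.injective (Subtype.ext h)
      simp [this] at hij
  · rintro (i | i) (j | j) hij
    · exact congrArg Sum.inl (eX.symm.injective (Subtype.ext hij))
    · exact absurd hij (disjoint_iff_ne.1 hXY _ (eX.symm i).2 _ (eY.symm j).2)
    · exact absurd hij.symm (disjoint_iff_ne.1 hXY _ (eX.symm j).2 _ (eY.symm i).2)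
    · exact congrArg Sum.inr (eY.symm.injective (Subtype.ext hij))

/-- Termwise comparison of $\sum_{i\le d}\binom{u}{i}$, where $u$ is the size of `U`, with the
Vandermonde sum for $\binom{u+d}{d}$. -/
theorem card_small_subsets_le {V : Type*} (U : Finset V) (d : ℕ) :
    #{R ∈ U.powerset | #R ≤ d} ≤ (#U + d).choose d := by
  classical
  have h1 : #{R ∈ U.powerset | #R ≤ d} = ∑ i ∈ range (d + 1), (#U).choose i := by
    rw [card_eq_sum_card_fiberwise (f := card) (t := range (d + 1)) (by
      intro R hR
      have := (mem_filter.1 (mem_coe.1 hR)).2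
      simp only [coe_range, Set.mem_Iio]
      omega)]
    refine sum_congr rfl fun i hi => ?_
    rw [← card_powersetCard]
    congr 1
    ext R
    simp only [mem_filter, mem_powerset, mem_powersetCard]
    rw [mem_range] at hi
    constructor
    · rintro ⟨⟨h1, -⟩, h3⟩; exact ⟨h1, h3⟩
    · rintro ⟨h1, h3⟩; exact ⟨⟨h1, by omega⟩, h3⟩
  rw [h1, Nat.add_choose_eq,
    Nat.sum_antidiagonal_eq_sum_range_succ fun i j => (#U).choose i * d.choose j]
  exact sum_le_sum fun i _ => Nat.le_mul_of_pos_right _ (Nat.choose_pos (Nat.sub_le d i))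

theorem eq_of_inter_eq_of_sdiff_eq {V : Type*} [DecidableEq V] {F F' B : Finset V}
    (h1 : F ∩ B = F' ∩ B) (h2 : F \ B = F' \ B) : F = F' := by
  rw [← sdiff_union_inter F B, h1, h2, sdiff_union_inter]

theorem card_family_le_of_sdiff_le {V : Type*} [Fintype V] [DecidableEq V]
    (𝓕 : Finset (Finset V)) (B : Finset V) (d : ℕ) (h : ∀ F ∈ 𝓕, #(F \ B) ≤ d) :
    #𝓕 ≤ 2 ^ #B * (Fintype.card V - #B + d).choose d := by
  calc #𝓕 ≤ #(B.powerset ×ˢ {R ∈ Bᶜ.powerset | #R ≤ d}) := by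
        refine card_le_card_of_injOn (fun F => (F ∩ B, F \ B)) ?_ ?_
        · intro F hF
          rw [mem_coe, mem_product, mem_powerset, mem_filter, mem_powerset]
          exact ⟨inter_subset_right, fun v hv => mem_compl.2 (mem_sdiff.1 hv).2, h F hF⟩
        · intro F _ F' _ hFF
          exact eq_of_inter_eq_of_sdiff_eq (congrArg Prod.fst hFF) (congrArg Prod.snd hFF)
    _ ≤ _ := by
        rw [card_product, card_powerset, ← card_compl]
        exact Nat.mul_le_mul_left _ (card_small_subsets_le _ _)

/-- A nontrivial `a`-intersecting family of `k`-sets is small. -/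
theorem card_intersecting_family_le {V : Type*} [Fintype V] [DecidableEq V]
    (𝓕 : Finset (Finset V)) {a d k : ℕ} (hk : a + d + 1 = k) (hcard : ∀ F ∈ 𝓕, #F = k)
    (hint : ∀ F ∈ 𝓕, ∀ F' ∈ 𝓕, a ≤ #(F ∩ F'))
    (hnt : ∀ A : Finset V, #A = a → ∃ F ∈ 𝓕, ¬ A ⊆ F) {B : Finset V} (hB : B ∈ 𝓕) :
    #𝓕 ≤ k * (Fintype.card V - k + d).choose d * 2 ^ k := by
  have hBk := hcard B hB
  have hN := card_small_subsets_le Bᶜ d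
  rw [card_compl, hBk] at hN
  have key := card_le_mul_card_image_of_maps_to (s := 𝓕) (t := B.powerset) (f := fun F => F ∩ B)
    (fun F _ => mem_powerset.2 inter_subset_right)
    (k * (Fintype.card V - k + d).choose d) ?_
  · rwa [card_powerset, hBk] at key
  -- Fix the trace `S` on `B`. Fewer than $a$ elements is impossible, and more than $a$ leaves at
  -- most $d$ elements outside `B`. With exactly $a$, nontriviality supplies a member `B'` not
  -- containing `S`; then `F` has an element of `B'` outside `B`, with $k$ candidates, and $d$ more
  -- elements remain.
  intro S hS
  have hinj : Set.InjOn (fun F => F \ B) ({F ∈ 𝓕 | F ∩ B = S} : Finset (Finset V)) := by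
    intro F hF F' hF' h
    exact eq_of_inter_eq_of_sdiff_eq
      ((mem_filter.1 (mem_coe.1 hF)).2.trans (mem_filter.1 (mem_coe.1 hF')).2.symm) h
  have hsd : ∀ F ∈ 𝓕, F ∩ B = S → #S + #(F \ B) = k := by
    intro F hF h
    rw [← h, card_inter_add_card_sdiff, hcard F hF]
  rcases lt_trichotomy #S a with hlt | heq | hgt
  · rw [filter_false_of_mem, card_empty]
    · exact Nat.zero_le _
    · intro F hF h
      have := hint F hF B hB
      rw [h] at this
      omega
  · obtain ⟨B', hB', hSB'⟩ := hnt S heq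
    calc #{F ∈ 𝓕 | F ∩ B = S}
        ≤ #((B' ×ˢ {R ∈ Bᶜ.powerset | #R ≤ d}).image fun x => insert x.1 x.2) := by
          refine card_le_card_of_injOn (fun F => F \ B) ?_ hinj
          intro F hF
          obtain ⟨hF, hFS⟩ := mem_filter.1 (mem_coe.1 hF)
          obtain ⟨b, hbF, hbB', hbS⟩ : ∃ b, b ∈ F ∧ b ∈ B' ∧ b ∉ S := by
            by_contra hcon
            push Not at hcon
            refine hSB' ?_
            have hsub : F ∩ B' ⊆ S := fun b hb =>
              hcon b (mem_inter.1 hb).1 (mem_inter.1 hb).2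
            rw [← eq_of_subset_of_card_le hsub (heq.trans_le (hint F hF B' hB'))]
            exact inter_subset_right
          have hbB : b ∉ B := fun h => hbS (hFS ▸ mem_inter.2 ⟨hbF, h⟩)
          have hbm : b ∈ F \ B := mem_sdiff.2 ⟨hbF, hbB⟩
          refine mem_coe.2 (mem_image.2 ⟨(b, (F \ B).erase b), ?_, insert_erase hbm⟩)
          rw [mem_product, mem_filter, mem_powerset]
          refine ⟨hbB', fun v hv => mem_compl.2 (mem_sdiff.1 (mem_of_mem_erase hv)).2, ?_⟩
          have := hsd F hF hFS
          rw [card_erase_of_mem hbm]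
          omega
      _ ≤ _ := by
          refine card_image_le.trans ?_
          rw [card_product, hcard B' hB']
          exact Nat.mul_le_mul_left _ hN
  · calc #{F ∈ 𝓕 | F ∩ B = S} ≤ #{R ∈ Bᶜ.powerset | #R ≤ d} := by
          refine card_le_card_of_injOn (fun F => F \ B) ?_ hinj
          intro F hF
          obtain ⟨hF, hFS⟩ := mem_filter.1 (mem_coe.1 hF)
          have := hsd F hF hFS
          have hd : #(F \ B) ≤ d := by omega
          exact mem_coe.2 (mem_filter.2 ⟨mem_powerset.2 fun v hv =>
            mem_compl.2 (mem_sdiff.1 hv).2, hd⟩)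
      _ ≤ _ := hN.trans (Nat.le_mul_of_pos_left _ (by omega))

/-! ### The numerical threshold for $n$ -/

theorem exp_one_sq_bounds : 7 < Real.exp 1 ^ 2 ∧ Real.exp 1 ^ 2 < 7.39 := by
  have h1 := Real.exp_one_gt_d9
  have h2 := Real.exp_one_lt_d9
  constructor <;> nlinarith

theorem pow_mul_exp_lt {k : ℕ} (hk : 3 ≤ k) :
    2 ^ k * Real.exp 1 ^ (k - 1) < (k : ℝ) ^ 3 * (k : ℝ) ^ ((k : ℝ) / 2) := by
  have hk0 : (0 : ℝ) < k := by positivity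
  obtain ⟨he1, he2⟩ := exp_one_sq_bounds
  -- After squaring, the claim is $(4e^2)^k<e^2k^{k+6}$, and $29.56=4\cdot7.39$ and $7$ are the
  -- rational bounds for $4e^2$ and $e^2$. Only $k<30$ needs checking.
  have hnum : (29.56 : ℝ) ^ k ≤ 7 * (k : ℝ) ^ (k + 6) := by
    rcases lt_or_ge k 30 with h | h
    · interval_cases k <;> norm_num
    · calc (29.56 : ℝ) ^ k ≤ (k : ℝ) ^ k := by
            refine pow_le_pow_left₀ (by norm_num) ?_ k
            have : (30 : ℝ) ≤ k := by exact_mod_cast h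
            linarith
        _ ≤ (k : ℝ) ^ (k + 6) :=
            pow_le_pow_right₀ (by exact_mod_cast (show 1 ≤ k by omega)) (by omega)
        _ ≤ 7 * (k : ℝ) ^ (k + 6) := by
            have : 0 < (k : ℝ) ^ (k + 6) := by positivity
            linarith
  refine lt_of_pow_lt_pow_left₀ 2 (by positivity) ?_
  have hhalf : ((k : ℝ) ^ ((k : ℝ) / 2)) ^ 2 = (k : ℝ) ^ k := by
    rw [← Real.rpow_natCast, ← Real.rpow_mul hk0.le]
    norm_num
  have hsq : (2 ^ k * Real.exp 1 ^ (k - 1)) ^ 2 * Real.exp 1 ^ 2 = (4 * Real.exp 1 ^ 2) ^ k := by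
    obtain ⟨t, rfl⟩ : ∃ t, k = t + 1 := ⟨k - 1, by omega⟩
    generalize Real.exp 1 = x
    calc (2 ^ (t + 1) * x ^ (t + 1 - 1)) ^ 2 * x ^ 2 = ((2 * x) ^ (t + 1)) ^ 2 := by
          rw [Nat.add_sub_cancel]; ring
      _ = ((2 * x) ^ 2) ^ (t + 1) := by
          rw [← pow_mul, ← pow_mul, mul_comm (t + 1) 2]
      _ = _ := by ring
  have h1 : (2 ^ k * Real.exp 1 ^ (k - 1)) ^ 2 * Real.exp 1 ^ 2
      < ((k : ℝ) ^ 3 * (k : ℝ) ^ ((k : ℝ) / 2)) ^ 2 * Real.exp 1 ^ 2 := by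
    rw [hsq, mul_pow ((k : ℝ) ^ 3), hhalf]
    calc (4 * Real.exp 1 ^ 2) ^ k < (29.56 : ℝ) ^ k :=
          pow_lt_pow_left₀ (by linarith) (by positivity) (by omega)
      _ ≤ 7 * (k : ℝ) ^ (k + 6) := hnum
      _ ≤ Real.exp 1 ^ 2 * (k : ℝ) ^ (k + 6) :=
          mul_le_mul_of_nonneg_right he1.le (by positivity)
      _ = _ := by ring
  exact lt_of_mul_lt_mul_right h1 (by positivity)

/-- With $k=r+d$, one has $k\le re^{d/2}$, so replacing $k^4$ by $r^4$ costs $e^{2d}$; since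
$p+2d=k-1$, this reduces to `pow_mul_exp_lt`. -/
theorem mul_pow_mul_exp_lt {r k p : ℕ} (hr : 3 ≤ r) (hrk : r ≤ k) (hp : p + k + 1 = 2 * r) :
    (k : ℝ) * 2 ^ k * Real.exp 1 ^ p < (r : ℝ) ^ 4 * (k : ℝ) ^ ((k : ℝ) / 2) := by
  obtain ⟨d, rfl⟩ := Nat.exists_eq_add_of_le hrk
  have h := pow_mul_exp_lt (k := r + d) (by omega)
  have hr0 : (0 : ℝ) < r := by positivity
  have hkr : ((r + d : ℕ) : ℝ) ≤ r * Real.exp (d / 2) := by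
    have h1 := Real.add_one_le_exp ((d : ℝ) / 2)
    have h3 : (3 : ℝ) ≤ r := by exact_mod_cast hr
    have h4 : (r : ℝ) * ((d : ℝ) / 2 + 1) ≤ r * Real.exp (d / 2) :=
      mul_le_mul_of_nonneg_left h1 hr0.le
    have h5 : (0 : ℝ) ≤ d := by positivity
    push_cast
    nlinarith
  have hkr4 : ((r + d : ℕ) : ℝ) ^ 4 ≤ (r : ℝ) ^ 4 * Real.exp 1 ^ (2 * d) := by
    refine (pow_le_pow_left₀ (by positivity) hkr 4).trans (le_of_eq ?_)
    rw [mul_pow, ← Real.exp_nat_mul, ← Real.exp_nat_mul]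
    congr 2
    push_cast
    ring
  have hE : (0 : ℝ) < Real.exp 1 ^ (2 * d) := by positivity
  refine lt_of_mul_lt_mul_right ?_ hE.le
  have hexp : Real.exp 1 ^ p * Real.exp 1 ^ (2 * d) = Real.exp 1 ^ (r + d - 1) := by
    rw [← pow_add]
    congr 1
    omega
  have hk0 : (0 : ℝ) < ((r + d : ℕ) : ℝ) := by positivity
  calc ((r + d : ℕ) : ℝ) * 2 ^ (r + d) * Real.exp 1 ^ p * Real.exp 1 ^ (2 * d)
      = ((r + d : ℕ) : ℝ) * (2 ^ (r + d) * Real.exp 1 ^ (r + d - 1)) := by rw [← hexp]; ring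
    _ < ((r + d : ℕ) : ℝ) * (((r + d : ℕ) : ℝ) ^ 3
          * ((r + d : ℕ) : ℝ) ^ (((r + d : ℕ) : ℝ) / 2)) := mul_lt_mul_of_pos_left h hk0
    _ = ((r + d : ℕ) : ℝ) ^ 4 * ((r + d : ℕ) : ℝ) ^ (((r + d : ℕ) : ℝ) / 2) := by ring
    _ ≤ (r : ℝ) ^ 4 * Real.exp 1 ^ (2 * d) * ((r + d : ℕ) : ℝ) ^ (((r + d : ℕ) : ℝ) / 2) :=
        mul_le_mul_of_nonneg_right hkr4 (by positivity)
    _ = _ := by ring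

/-- The bound for the number of large cliques in the nontrivial case is below the clique spectral
radius of the extremal graph. -/
theorem bound_lt_prod_rpow {r k n p : ℕ} (hr : 3 ≤ r) (hrk : r ≤ k) (hp : p + k + 1 = 2 * r)
    (hp0 : 0 < p) (hkn : k ≤ n)
    (hn : (2 * (r : ℝ) - k - 1) *
        (Real.exp 1 * (r : ℝ) ^ 4 * (k : ℝ) ^ ((k : ℝ) / 2)) ^ ((k : ℝ) / (2 * k - 2 * r + 1)) + k
          ≤ (n : ℝ)) :
    ((k * (n - k + (p - 1)).choose (p - 1) * 2 ^ k : ℕ) : ℝ)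
      < (∏ j ∈ range p, (((n - k + p + (p - 1 - j)) / p : ℕ) : ℝ)) ^ (((k : ℝ) - 1) / k) := by
  set D : ℝ := Real.exp 1 * (r : ℝ) ^ 4 * (k : ℝ) ^ ((k : ℝ) / 2) with hD
  have hpR : (2 * (r : ℝ) - k - 1) = p := by
    have : ((p + k + 1 : ℕ) : ℝ) = ((2 * r : ℕ) : ℝ) := by rw [hp]
    push_cast at this
    linarith
  have hkp : p < k := by omega
  have hk0 : (0 : ℝ) < k := by exact_mod_cast (show 0 < k by omega)
  have hpk : (p : ℝ) < k := by exact_mod_cast hkp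
  have hp0' : (0 : ℝ) < p := by exact_mod_cast hp0
  have haR : (2 * (k : ℝ) - 2 * r + 1) = k - p := by linarith
  rw [hpR, haR] at hn
  -- As $2k-2r+1=k-p$, the hypothesis on $n$ says $D\le x^{(k-p)/k}$, and every Turán class has more
  -- than $x$ vertices.
  set x : ℝ := ((n : ℝ) - k) / p with hx
  have hDx : D ^ ((k : ℝ) / (k - p)) ≤ x := by
    rw [hx, le_div_iff₀ hp0']
    linarith
  have hr3 : (3 : ℝ) ≤ r := by exact_mod_cast hr
  have hk1 : (1 : ℝ) ≤ k := by exact_mod_cast (show 1 ≤ k by omega)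
  have hDr : 2 * (r : ℝ) ≤ D := by
    have h1 : 1 ≤ Real.exp 1 := by linarith [Real.add_one_le_exp (1 : ℝ)]
    have h2 : 1 ≤ (k : ℝ) ^ ((k : ℝ) / 2) := Real.one_le_rpow hk1 (by positivity)
    have h3 : 2 * (r : ℝ) ≤ (r : ℝ) ^ 4 := by
      have : (2 : ℝ) ≤ (r : ℝ) ^ 3 := by
        calc (2 : ℝ) ≤ 3 ^ 3 := by norm_num
          _ ≤ _ := pow_le_pow_left₀ (by norm_num) hr3 3
      calc 2 * (r : ℝ) ≤ (r : ℝ) ^ 3 * r := by gcongr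
        _ = _ := by ring
    calc 2 * (r : ℝ) ≤ 1 * (r : ℝ) ^ 4 * 1 := by linarith
      _ ≤ D := by rw [hD]; gcongr
  have hD1 : 1 ≤ D := by linarith
  have hD0 : 0 < D := by linarith
  have hxD : D ≤ x := by
    refine le_trans ?_ hDx
    refine Real.self_le_rpow_of_one_le hD1 ?_
    rw [le_div_iff₀ (by linarith)]
    linarith
  have hx0 : 0 < x := hD0.trans_le hxD
  have hpx : (p : ℝ) ≤ x := by
    have : (p : ℝ) ≤ 2 * r := by linarith
    linarith
  have hxa : D ≤ x ^ (((k : ℝ) - p) / k) := by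
    have h1 := Real.rpow_le_rpow (by positivity) hDx
      (show 0 ≤ ((k : ℝ) - p) / k from div_nonneg (by linarith) hk0.le)
    rw [← Real.rpow_mul hD0.le, div_mul_div_cancel₀ (by linarith), div_self hk0.ne',
      Real.rpow_one] at h1
    exact h1
  have hnk : ((n - k : ℕ) : ℝ) = p * x := by
    rw [Nat.cast_sub hkn, hx, mul_div_cancel₀ _ hp0'.ne']
  have hprod : x ^ p ≤ ∏ j ∈ range p, (((n - k + p + (p - 1 - j)) / p : ℕ) : ℝ) := by
    rw [← card_range p, ← prod_const, card_range]
    refine prod_le_prod (fun _ _ => hx0.le) fun j _ => ?_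
    have h1 : n - k < p * ((n - k + p + (p - 1 - j)) / p) := by
      have h2 : (n - k + p) / p ≤ (n - k + p + (p - 1 - j)) / p :=
        Nat.div_le_div_right (by omega)
      rw [Nat.add_div_right _ hp0] at h2
      exact (Nat.lt_mul_div_succ (n - k) hp0).trans_le (Nat.mul_le_mul_left p h2)
    have h3 : ((n - k : ℕ) : ℝ) < p * (((n - k + p + (p - 1 - j)) / p : ℕ) : ℝ) := by
      exact_mod_cast h1
    rw [hnk] at h3
    exact (lt_of_mul_lt_mul_left h3 hp0'.le).le
  have hrhs : x ^ (p - 1) * D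
      ≤ (∏ j ∈ range p, (((n - k + p + (p - 1 - j)) / p : ℕ) : ℝ)) ^ (((k : ℝ) - 1) / k) := by
    refine le_trans ?_ (Real.rpow_le_rpow (by positivity) hprod
      (div_nonneg (by linarith) hk0.le))
    -- The exponent splits as $p(k-1)/k=(p-1)+(k-p)/k$; the surplus pays for `D`.
    have : (x ^ p) ^ (((k : ℝ) - 1) / k) = x ^ (p - 1) * x ^ (((k : ℝ) - p) / k) := by
      rw [← Real.rpow_natCast x p, ← Real.rpow_natCast x (p - 1), ← Real.rpow_mul hx0.le,
        ← Real.rpow_add hx0, Nat.cast_sub hp0]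
      congr 1
      field_simp
      push_cast
      ring
    rw [this]
    exact mul_le_mul_of_nonneg_left hxa (by positivity)
  refine lt_of_lt_of_le ?_ hrhs
  -- One factor $e$ comes from $(1+1/x)^{p-1}\le e$, valid since $p\le x$; the factor $e^p$ bounds
  -- $p^{p-1}/(p-1)!$.
  have hchoose : ((n - k + (p - 1)).choose (p - 1) : ℝ) ≤ x ^ (p - 1) * Real.exp 1
      * Real.exp 1 ^ p := by
    have h1 : ((n - k + (p - 1) : ℕ) : ℝ) ≤ p * (x + 1) := by
      push_cast [hnk, Nat.cast_sub hp0]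
      linarith
    have h2 : (x + 1) ^ (p - 1) ≤ x ^ (p - 1) * Real.exp 1 := by
      have h3 : x + 1 ≤ x * Real.exp (1 / x) := by
        have := mul_le_mul_of_nonneg_left (Real.add_one_le_exp (1 / x)) hx0.le
        have h4 : x * (1 / x + 1) = x + 1 := by field_simp; ring
        linarith
      refine (pow_le_pow_left₀ (by positivity) h3 _).trans ?_
      rw [mul_pow, ← Real.exp_nat_mul]
      refine mul_le_mul_of_nonneg_left (Real.exp_le_exp.2 ?_) (by positivity)
      rw [mul_one_div, div_le_one hx0, Nat.cast_sub hp0]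
      push_cast
      linarith
    have h5 : (p : ℝ) ^ (p - 1) / (p - 1).factorial ≤ Real.exp 1 ^ p := by
      rw [← Real.exp_nat_mul, mul_one]
      exact Real.pow_div_factorial_le_exp _ hp0'.le _
    calc ((n - k + (p - 1)).choose (p - 1) : ℝ)
        ≤ ((n - k + (p - 1) : ℕ) : ℝ) ^ (p - 1) / (p - 1).factorial := Nat.choose_le_pow_div _ _
      _ ≤ (p * (x + 1)) ^ (p - 1) / (p - 1).factorial := by gcongr
      _ = (x + 1) ^ (p - 1) * ((p : ℝ) ^ (p - 1) / (p - 1).factorial) := by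
          rw [mul_pow]; ring
      _ ≤ _ := by gcongr
  have hkey := mul_pow_mul_exp_lt hr hrk hp
  push_cast
  calc (k : ℝ) * ((n - k + (p - 1)).choose (p - 1) : ℝ) * 2 ^ k
      ≤ (k : ℝ) * (x ^ (p - 1) * Real.exp 1 * Real.exp 1 ^ p) * 2 ^ k := by gcongr
    _ = x ^ (p - 1) * Real.exp 1 * ((k : ℝ) * 2 ^ k * Real.exp 1 ^ p) := by ring
    _ < x ^ (p - 1) * Real.exp 1 * ((r : ℝ) ^ 4 * (k : ℝ) ^ ((k : ℝ) / 2)) :=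
        mul_lt_mul_of_pos_left hkey (by positivity)
    _ = _ := by rw [hD]; ring

/-! ### The case analysis -/

theorem cliquesIn_eq_empty_of_le {V : Type*} {G : SimpleGraph V} {W : Finset V} {s t : ℕ}
    (hst : s ≤ t) (h : cliquesIn G W s = ∅) : cliquesIn G W t = ∅ := by
  refine eq_empty_of_forall_notMem fun C hC => ?_
  obtain ⟨h1, h2, h3⟩ := mem_cliquesIn.1 hC
  obtain ⟨D, hD, hDs⟩ := exists_subset_card_eq (hst.trans_eq h2.symm)
  have : D ∈ cliquesIn G W s :=
    mem_cliquesIn.2 ⟨hD.trans h1, hDs, h3.subset (by exact_mod_cast hD)⟩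
  rw [h] at this
  exact notMem_empty _ this

theorem sum_cliqueSpectralRadius_eq {V : Type*} [Fintype V] {G : SimpleGraph V} {k t : ℕ}
    (hkt : k ≤ t) (h : cliquesIn G univ (k + 1) = ∅) :
    ∑ s ∈ Icc k t, cliqueSpectralRadius G s = cliqueSpectralRadius G k := by
  refine sum_eq_single_of_mem k (mem_Icc.2 ⟨le_rfl, hkt⟩) fun s hs hsk => ?_
  have := (mem_Icc.1 hs).1
  exact cliqueSpectralRadius_eq_zero G (cliquesIn_eq_empty_of_le (by omega) h)

theorem ncard_cliqueSet {V : Type*} [Fintype V] (G : SimpleGraph V) (k : ℕ) :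
    (G.cliqueSet k).ncard = #(cliquesIn G univ k) := by
  rw [← Set.ncard_coe_finset]
  congr 1
  ext C
  rw [SimpleGraph.mem_cliqueSet_iff, mem_coe, mem_cliquesIn, SimpleGraph.isNClique_iff]
  simp [and_comm]

/-- Relative to a fixed $(k+1)$-clique, every clique counted has at most $(2r-1)-(k+1)=p-1$ new
vertices. All sizes are counted as one family, and the surplus factor $2$ in $2^{k+1}$ is absorbed
by $k$, giving the same bound as for intersecting families. -/
theorem sum_cliqueSpectralRadius_le_of_clique {V : Type*} [Fintype V] {G : SimpleGraph V}
    {r k p : ℕ} (hr : 3 ≤ r) (hrk : r ≤ k) (hp : p + k + 1 = 2 * r) (hp0 : 0 < p)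
    (hfree : SimpleGraph.Free ((⊤ : SimpleGraph (Fin r)) ⊕g (⊤ : SimpleGraph (Fin r))) G)
    (h : (cliquesIn G univ (k + 1)).Nonempty) :
    ∑ s ∈ Icc k (2 * r - 1), cliqueSpectralRadius G s
      ≤ ((k * (Fintype.card V - k + (p - 1)).choose (p - 1) * 2 ^ k : ℕ) : ℝ) := by
  classical
  obtain ⟨B, hB⟩ := h
  obtain ⟨-, hBc, hBcl⟩ := mem_cliquesIn.1 hB
  have h1 : ∑ s ∈ Icc k (2 * r - 1), cliqueSpectralRadius G s
      ≤ ((∑ s ∈ Icc k (2 * r - 1), #(cliquesIn G univ s) : ℕ) : ℝ) := by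
    push_cast
    exact sum_le_sum fun s _ => cliqueSpectralRadius_le_card G s
  refine h1.trans (Nat.cast_le.2 ?_)
  rw [← card_biUnion]
  · refine (card_family_le_of_sdiff_le _ B (p - 1) ?_).trans ?_
    · intro F hF
      obtain ⟨s, hs, hF⟩ := mem_biUnion.1 hF
      obtain ⟨-, hFc, hFcl⟩ := mem_cliquesIn.1 hF
      have hs := (mem_Icc.1 hs).1
      have h2 := card_union_le_of_free (by omega) hfree hFcl hBcl (by omega) (by omega)
      have h3 : #(F \ B) + #B = #(F ∪ B) := card_sdiff_add_card F B
      omega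
    · rw [hBc]
      have h4 : (Fintype.card V - (k + 1) + (p - 1)).choose (p - 1)
          ≤ (Fintype.card V - k + (p - 1)).choose (p - 1) := Nat.choose_le_choose _ (by omega)
      calc _ ≤ 2 ^ (k + 1) * (Fintype.card V - k + (p - 1)).choose (p - 1) :=
            Nat.mul_le_mul_left _ h4
        _ = 2 * ((Fintype.card V - k + (p - 1)).choose (p - 1) * 2 ^ k) := by ring
        _ ≤ k * ((Fintype.card V - k + (p - 1)).choose (p - 1) * 2 ^ k) :=
            Nat.mul_le_mul_right _ (by omega)
        _ = _ := by ring
  · intro s _ t _ hst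
    refine disjoint_left.2 fun F hF hF' => hst ?_
    rw [← (mem_cliquesIn.1 hF).2.1, (mem_cliquesIn.1 hF').2.1]

theorem iso_extremalGraph {V : Type*} [Fintype V] [DecidableEq V] (G : SimpleGraph V) {r k n : ℕ}
    (hp0 : 0 < 2 * r - 1 - k) (hpm : 2 * r - 1 - k ≤ n - (2 * k + 1 - 2 * r))
    (hcard : Fintype.card V = n) (A : Finset V) (hA : #A = 2 * k + 1 - 2 * r) (hAcl : G.IsClique A)
    (hAadj : ∀ u ∈ A, ∀ v ∈ Aᶜ, G.Adj u v) (c : V → ℕ) (hc : ∀ v ∈ Aᶜ, c v < 2 * r - 1 - k)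
    (hadj : ∀ u ∈ Aᶜ, ∀ v ∈ Aᶜ, G.Adj u v ↔ c u ≠ c v)
    (hbal : ∀ j < 2 * r - 1 - k,
      #{v ∈ Aᶜ | c v = j} = (n - (2 * k + 1 - 2 * r)) / (2 * r - 1 - k) ∨
      #{v ∈ Aᶜ | c v = j} = (n - (2 * k + 1 - 2 * r)) / (2 * r - 1 - k) + 1) :
    Nonempty (G ≃g extremalGraph r k n) := by
  have hcardA : Fintype.card {v // ¬ v ∈ A} = n - (2 * k + 1 - 2 * r) := by
    rw [Fintype.card_subtype_compl, Fintype.card_coe, hcard, hA]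
  have hcount : ∀ j, #{v : {v // ¬ v ∈ A} | c v = j} = #{v ∈ Aᶜ | c v = j} := by
    intro j
    refine card_bij (fun v _ => (v : V)) ?_ ?_ ?_
    · intro v hv
      exact mem_filter.2 ⟨mem_compl.2 v.2, (mem_filter.1 hv).2⟩
    · intro u _ v _ h
      exact Subtype.ext h
    · intro v hv
      obtain ⟨h1, h2⟩ := mem_filter.1 hv
      exact ⟨⟨v, mem_compl.1 h1⟩, by simpa using h2, rfl⟩
  obtain ⟨e₁⟩ := iso_turanGraph_of_balanced (G.comap (Subtype.val : {v // ¬ v ∈ A} → V)) hp0 hpm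
    hcardA (fun v => c v) (fun v => hc v (mem_compl.2 v.2))
    (fun u v => hadj u (mem_compl.2 u.2) v (mem_compl.2 v.2))
    (fun j hj => by rw [hcount]; exact hbal j hj)
  obtain ⟨e₂⟩ := balancedPartite_iso_turanGraph (2 * r - 1 - k) (n - (2 * k + 1 - 2 * r)) hp0
  let e := e₁.trans e₂.symm
  let eA := A.equivFinOfCardEq hA
  refine ⟨SimpleGraph.Iso.symm ⟨(Equiv.sumCongr eA e.toEquiv).symm.trans
    (Equiv.sumCompl (· ∈ A)), ?_⟩⟩
  have he (u v) : (balancedPartite (2 * r - 1 - k) (n - (2 * k + 1 - 2 * r))).Adj u v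
      ↔ G.Adj (e.symm u) (e.symm v) := by
    rw [← e.symm.map_rel_iff]
    rfl
  rintro (u | u) (v | v)
  · have h1 : (extremalGraph r k n).Adj (Sum.inl u) (Sum.inl v) ↔ u ≠ v := by
      simp [extremalGraph_adj, extremalClass]
    rw [h1]
    change G.Adj (eA.symm u) (eA.symm v) ↔ _
    constructor
    · rintro h rfl
      exact G.loopless.irrefl _ h
    · intro h
      exact hAcl (eA.symm u).2 (eA.symm v).2 fun h' => h (eA.symm.injective (Subtype.ext h'))
  · have h1 : (extremalGraph r k n).Adj (Sum.inl u) (Sum.inr v) := by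
      simp [extremalGraph_adj, extremalClass]
    exact iff_of_true (hAadj _ (eA.symm u).2 _ (mem_compl.2 (e.symm v).2)) h1
  · have h1 : (extremalGraph r k n).Adj (Sum.inr u) (Sum.inl v) := by
      simp [extremalGraph_adj, extremalClass]
    exact iff_of_true (hAadj _ (eA.symm v).2 _ (mem_compl.2 (e.symm u).2)).symm h1
  · have h1 : (extremalGraph r k n).Adj (Sum.inr u) (Sum.inr v)
        ↔ (balancedPartite (2 * r - 1 - k) (n - (2 * k + 1 - 2 * r))).Adj u v := by
      simp [extremalGraph, graphJoin]
    rw [h1, he]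
    rfl

/-- If all `k`-cliques share a set of `2k-2r+1` vertices and there is no `(k+1)`-clique, then `G`
has fewer `k`-cliques than the extremal graph, or is isomorphic to it. -/
theorem card_cliquesIn_lt_or_iso {V : Type*} [Fintype V] [DecidableEq V] (G : SimpleGraph V)
    {r k n : ℕ} (hrk : r ≤ k) (hkr : k ≤ 2 * r - 2) (hr : 3 ≤ r) (hkn : k ≤ n)
    (hcard : Fintype.card V = n) (hG : cliquesIn G univ (k + 1) = ∅)
    (hne : (cliquesIn G univ k).Nonempty) (A : Finset V) (hA : #A = 2 * k + 1 - 2 * r)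
    (hAC : ∀ C ∈ cliquesIn G univ k, A ⊆ C) :
    #(cliquesIn G univ k) < ∏ j ∈ range (2 * r - 1 - k),
        (n - (2 * k + 1 - 2 * r) + (2 * r - 1 - k - 1 - j)) / (2 * r - 1 - k) ∨
      Nonempty (G ≃g extremalGraph r k n) := by
  classical
  have hAcl : G.IsClique A := by
    obtain ⟨C, hC⟩ := hne
    exact (mem_cliquesIn.1 hC).2.2.subset (by exact_mod_cast hAC C hC)
  -- The common neighbours of `A`: a clique of $2r-k$ vertices in `W` would join `A` to form a
  -- $(k+1)$-clique, while each $k$-clique minus `A` lies in `W`.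
  set W : Finset V := {v ∈ Aᶜ | ∀ u ∈ A, G.Adj u v} with hW
  have hWA : W ⊆ Aᶜ := filter_subset _ _
  have hcA : #Aᶜ = n - (2 * k + 1 - 2 * r) := by rw [card_compl, hcard, hA]
  have hWe : cliquesIn G W (2 * r - 1 - k + 1) = ∅ := by
    refine eq_empty_of_forall_notMem fun D hD => ?_
    obtain ⟨h1, h2, h3⟩ := mem_cliquesIn.1 hD
    have hdisj : Disjoint A D := disjoint_left.2 fun v hv hv' =>
      mem_compl.1 (hWA (h1 hv')) hv
    have : A ∪ D ∈ cliquesIn G univ (k + 1) := by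
      refine mem_cliquesIn.2 ⟨subset_univ _, ?_, ?_⟩
      · rw [card_union_of_disjoint hdisj, hA, h2]; omega
      · intro u hu v hv huv
        rcases mem_union.1 (mem_coe.1 hu) with hu | hu <;>
          rcases mem_union.1 (mem_coe.1 hv) with hv | hv
        · exact hAcl hu hv huv
        · exact (mem_filter.1 (h1 hv)).2 u hu
        · exact ((mem_filter.1 (h1 hu)).2 v hv).symm
        · exact h3 hu hv huv
    rw [hG] at this
    exact notMem_empty _ this
  have hle : #(cliquesIn G univ k) ≤ #(cliquesIn G W (2 * r - 1 - k)) := by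
    refine card_le_card_of_injOn (fun C => C \ A) ?_ ?_
    · intro C hC
      obtain ⟨-, h2, h3⟩ := mem_cliquesIn.1 (mem_coe.1 hC)
      have hsub := hAC C hC
      refine mem_coe.2 (mem_cliquesIn.2 ⟨fun v hv => ?_, ?_, ?_⟩)
      · obtain ⟨hvC, hvA⟩ := mem_sdiff.1 hv
        refine mem_filter.2 ⟨mem_compl.2 hvA, fun u hu => ?_⟩
        exact h3 (hsub hu) hvC fun h => hvA (h ▸ hu)
      · rw [card_sdiff_of_subset hsub, h2, hA]; omega
      · exact h3.subset (by exact_mod_cast sdiff_subset)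
    · intro C hC C' hC' h
      have h' : C \ A = C' \ A := h
      rw [← sdiff_union_of_subset (hAC C hC), h', sdiff_union_of_subset (hAC C' hC')]
  have hp0 : 0 < 2 * r - 1 - k := by omega
  have hpm : 2 * r - 1 - k ≤ n - (2 * k + 1 - 2 * r) := by omega
  obtain ⟨-, hz⟩ := card_cliquesIn_le_balanced G hp0 hpm W ((card_le_card hWA).trans_eq hcA) hWe
  rcases lt_or_ge #(cliquesIn G univ k) (∏ j ∈ range (2 * r - 1 - k),
        (n - (2 * k + 1 - 2 * r) + (2 * r - 1 - k - 1 - j)) / (2 * r - 1 - k)) with hlt | hge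
  · exact Or.inl hlt
  · right
    obtain ⟨hWm, c, hc, hadj, hbal⟩ := hz (hge.trans hle)
    -- Equality in Zykov's bound forces `W` to have full size, so `A` is joined to all other
    -- vertices.
    have hWeq : W = Aᶜ := eq_of_subset_of_card_le hWA (by rw [hWm, hcA])
    have hAadj : ∀ u ∈ A, ∀ v ∈ Aᶜ, G.Adj u v := by
      intro u hu v hv
      rw [← hWeq] at hv
      exact (mem_filter.1 hv).2 u hu
    rw [hWeq] at hc hadj hbal
    exact iso_extremalGraph G hp0 hpm hcard A hA hAcl hAadj c hc hadj hbal

/-- Every branch gives strict inequality except the one where all $k$-cliques share a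
$(2k-2r+1)$-set and the Turán count is attained; hence the bound and its equality case come
together. -/
theorem sum_lt_or_iso {V : Type*} [Fintype V] (G : SimpleGraph V) {r k n : ℕ}
    (hr : 3 ≤ r) (hrk : r ≤ k) (hkr : k ≤ 2 * r - 2)
    (hcard : Fintype.card V = n) (hkn : k ≤ n)
    (hn : (2 * (r : ℝ) - k - 1) *
        (Real.exp 1 * (r : ℝ) ^ 4 * (k : ℝ) ^ ((k : ℝ) / 2)) ^ ((k : ℝ) / (2 * k - 2 * r + 1)) + k
          ≤ (n : ℝ))
    (hfree : SimpleGraph.Free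
      ((⊤ : SimpleGraph (Fin r)) ⊕g (⊤ : SimpleGraph (Fin r))) G) :
    ∑ s ∈ Icc k (2 * r - 1), cliqueSpectralRadius G s
        < cliqueSpectralRadius (extremalGraph r k n) k ∨
      Nonempty (G ≃g extremalGraph r k n) := by
  classical
  have hlow := extremalGraph_lower hr hrk (by omega) hkn
  rw [← prod_range fun j : ℕ => (((n - (2 * k + 1 - 2 * r) + (2 * r - 1 - k - 1 - j))
      / (2 * r - 1 - k) : ℕ) : ℝ)] at hlow
  have hbound := bound_lt_prod_rpow (p := 2 * r - 1 - k) hr hrk (by omega) (by omega) hkn hn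
  have hnk : n - k + (2 * r - 1 - k) = n - (2 * k + 1 - 2 * r) := by omega
  simp only [hnk] at hbound
  have hbound := hbound.trans_le hlow
  rcases (cliquesIn G univ (k + 1)).eq_empty_or_nonempty with hG | hG
  swap
  · left
    refine lt_of_le_of_lt ?_ hbound
    have := sum_cliqueSpectralRadius_le_of_clique (p := 2 * r - 1 - k) hr hrk (by omega)
      (by omega) hfree hG
    rwa [hcard] at this
  rw [sum_cliqueSpectralRadius_eq (by omega) hG]
  rcases (cliquesIn G univ k).eq_empty_or_nonempty with hk | hk
  · left
    rw [cliqueSpectralRadius_eq_zero G hk]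
    exact lt_of_le_of_lt (by positivity) hbound
  by_cases hcommon : ∃ A : Finset V, #A = 2 * k + 1 - 2 * r ∧ ∀ C ∈ cliquesIn G univ k, A ⊆ C
  · obtain ⟨A, hA, hAC⟩ := hcommon
    rcases card_cliquesIn_lt_or_iso G hrk hkr hr hkn hcard hG hk A hA hAC with hlt | hiso
    · left
      refine (cliqueSpectralRadius_le_card_rpow G (by omega) hG).trans_lt (lt_of_lt_of_le ?_ hlow)
      have hk1 : (1 : ℝ) < k := by exact_mod_cast (show 1 < k by omega)
      refine Real.rpow_lt_rpow (by positivity) ?_ (div_pos (by linarith) (by linarith))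
      exact_mod_cast hlt
    · exact Or.inr hiso
  · left
    push Not at hcommon
    refine (cliqueSpectralRadius_le_card G k).trans_lt (lt_of_le_of_lt ?_ hbound)
    obtain ⟨B, hB⟩ := hk
    rw [← hcard]
    refine Nat.cast_le.2 (card_intersecting_family_le (cliquesIn G univ k)
      (a := 2 * k + 1 - 2 * r) (by omega) (fun F hF => (mem_cliquesIn.1 hF).2.1) ?_ hcommon hB)
    intro F hF F' hF'
    obtain ⟨-, h1, h2⟩ := mem_cliquesIn.1 hF
    obtain ⟨-, h3, h4⟩ := mem_cliquesIn.1 hF'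
    have := card_union_le_of_free (by omega) hfree h2 h4 (by omega) (by omega)
    have := card_union_add_card_inter F F'
    omega

/-- For `k = 2r - 1` there is at most one `k`-clique. -/
theorem card_cliquesIn_le_one {V : Type*} [Fintype V] {G : SimpleGraph V} {r : ℕ} (hr : 1 ≤ r)
    (hfree : SimpleGraph.Free
      ((⊤ : SimpleGraph (Fin r)) ⊕g (⊤ : SimpleGraph (Fin r))) G) :
    #(cliquesIn G univ (2 * r - 1)) ≤ 1 := by
  classical
  refine card_le_one.2 fun F hF F' hF' => ?_
  obtain ⟨-, h1, h2⟩ := mem_cliquesIn.1 hF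
  obtain ⟨-, h3, h4⟩ := mem_cliquesIn.1 hF'
  have h5 := card_union_le_of_free hr hfree h2 h4 (by omega) (by omega)
  have h6 := eq_of_subset_of_card_le (subset_union_left : F ⊆ F ∪ F') (by omega)
  have h7 := eq_of_subset_of_card_le (subset_union_right : F' ⊆ F ∪ F') (by omega)
  rw [h6, ← h7]

theorem cliqueSpectralRadius_extremalGraph_eq_one {r n : ℕ} (hr : 3 ≤ r) (hn : 2 * r - 1 ≤ n) :
    cliqueSpectralRadius (extremalGraph r (2 * r - 1) n) (2 * r - 1) = 1 := by
  refine le_antisymm ?_ ?_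
  · refine (cliqueSpectralRadius_le_card _ _).trans ?_
    have : #(cliquesIn (extremalGraph r (2 * r - 1) n) univ (2 * r - 1)) ≤ 1 := by
      have hle : Fintype.card (Fin (2 * (2 * r - 1) + 1 - 2 * r) ⊕
          TuranVertex (2 * r - 1 - (2 * r - 1)) (n - (2 * (2 * r - 1) + 1 - 2 * r)))
            = 2 * r - 1 := by
        have : IsEmpty (TuranVertex (2 * r - 1 - (2 * r - 1))
            (n - (2 * (2 * r - 1) + 1 - 2 * r))) := ⟨fun v => by have := v.1.2; omega⟩
        rw [Fintype.card_sum, Fintype.card_fin, Fintype.card_eq_zero]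
        omega
      refine card_le_one.2 fun F hF F' hF' => ?_
      rw [(card_eq_iff_eq_univ F).1 ((mem_cliquesIn.1 hF).2.1.trans hle.symm),
        (card_eq_iff_eq_univ F').1 ((mem_cliquesIn.1 hF').2.1.trans hle.symm)]
    exact_mod_cast this
  · refine le_trans (le_of_eq ?_) (extremalGraph_lower hr (by omega) le_rfl hn)
    -- There are no Turán classes when $k=2r-1$, so the lower bound is a power of the empty product.
    have : IsEmpty (Fin (2 * r - 1 - (2 * r - 1))) := ⟨fun v => by have := v.2; omega⟩
    rw [prod_of_isEmpty, Real.one_rpow]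

theorem theorem1p6 {V : Type*} [Fintype V] (G : SimpleGraph V) (r k n : ℕ)
    (hr : 3 ≤ r) (hrk : r ≤ k) (hkr : k ≤ 2 * r - 1)
    (hcard : Fintype.card V = n)
    (hn : (2 * (r : ℝ) - k - 1) *
        (Real.exp 1 * (r : ℝ) ^ 4 * (k : ℝ) ^ ((k : ℝ) / 2)) ^ ((k : ℝ) / (2 * k - 2 * r + 1)) + k
          ≤ (n : ℝ))
    (hfree : SimpleGraph.Free
      ((⊤ : SimpleGraph (Fin r)) ⊕g (⊤ : SimpleGraph (Fin r))) G) :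
    (∑ s ∈ Finset.Icc k (2 * r - 1), cliqueSpectralRadius G s
        ≤ cliqueSpectralRadius (extremalGraph r k n) k) ∧
    (k = 2 * r - 1 →
      (∑ s ∈ Finset.Icc k (2 * r - 1), cliqueSpectralRadius G s
          = cliqueSpectralRadius (extremalGraph r k n) k ↔
        (G.cliqueSet k).ncard = 1)) ∧
    (k ≤ 2 * r - 2 →
      (∑ s ∈ Finset.Icc k (2 * r - 1), cliqueSpectralRadius G s
          = cliqueSpectralRadius (extremalGraph r k n) k ↔
        Nonempty (G ≃g extremalGraph r k n))) := by
  have hp : (0 : ℝ) ≤ 2 * (r : ℝ) - k - 1 := by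
    have : ((k + 1 : ℕ) : ℝ) ≤ ((2 * r : ℕ) : ℝ) := Nat.cast_le.2 (by omega)
    push_cast at this
    linarith
  have hkn : k ≤ n := by
    have : (k : ℝ) ≤ n := le_trans (le_add_of_nonneg_left (by positivity)) hn
    exact_mod_cast this
  rcases Nat.lt_or_ge (2 * r - 2) k with hk | hk
  · obtain rfl : k = 2 * r - 1 := by omega
    have hone := card_cliquesIn_le_one (by omega) hfree
    have hmu : ∑ s ∈ Finset.Icc (2 * r - 1) (2 * r - 1), cliqueSpectralRadius G s
        = cliqueSpectralRadius G (2 * r - 1) := by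
      rw [Finset.Icc_self, Finset.sum_singleton]
    have hle : cliqueSpectralRadius G (2 * r - 1) ≤ 1 :=
      (cliqueSpectralRadius_le_card G _).trans (by exact_mod_cast hone)
    rw [hmu, cliqueSpectralRadius_extremalGraph_eq_one hr hkn, ncard_cliqueSet]
    refine ⟨hle, fun _ => ⟨fun h => ?_, fun h => ?_⟩, fun h => by omega⟩
    · refine le_antisymm hone (Nat.one_le_iff_ne_zero.2 fun h0 => ?_)
      rw [cliqueSpectralRadius_eq_zero G (Finset.card_eq_zero.1 h0)] at h
      exact zero_ne_one h
    · exact le_antisymm hle (one_le_cliqueSpectralRadius_of_unique G (by omega) h)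
  -- The extremal graph has no $(k+1)$-clique, so after transport along the isomorphism only the
  -- term $s=k$ survives.
  · have hiso : Nonempty (G ≃g extremalGraph r k n) →
        ∑ s ∈ Finset.Icc k (2 * r - 1), cliqueSpectralRadius G s
          = cliqueSpectralRadius (extremalGraph r k n) k := by
      rintro ⟨e⟩
      simp only [cliqueSpectralRadius_congr e]
      exact sum_cliqueSpectralRadius_eq hkr
        (cliquesIn_extremalGraph_eq_empty hrk hkr (by omega) (Nat.lt_succ_self k))
    have hdich := sum_lt_or_iso G hr hrk hk hcard hkn hn hfree
    refine ⟨?_, fun h => by omega, fun _ => ⟨fun h => ?_, hiso⟩⟩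
    · rcases hdich with h | h
      · exact h.le
      · exact (hiso h).le
    · exact hdich.resolve_left h.not_lt
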